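/- Let $\lambda>0$, $\varepsilon>0$, $\alpha>2$, and let $\Phi$ be a homogeneous Poisson point process of intensity $\lambda$ in $\mathbb{R}^2$ (the base stations). For $x\in\Phi$ and each of two time slots $k\in\{1,2\}$ let $h_x(k)$ be the fading power gain of the link from $x$ to the user in slot $k$; the gains are exponentially distributed with mean $1$ (Rayleigh fading with unit mean power), independent over stations and time slots, and independent of $\Phi$. Let $\mathbb{E}[h^2]$ be the second moment of such a gain, and let $g(x)=\frac{1}{\varepsilon+\|x\|^{\alpha}}$ be the path-loss function. Consider a static user at the origin in both time slots. Let $x_2$ be the point of $\Phi$ closest to the origin (the serving station in both slots), and $r_2=\|x_2\|$. Let $$I(k)=\sum_{x\in\Phi,\;x\neq x_2}h_x(k)\,g(x),\qquad k=1,2,$$ be the interference in slot $k$, and let $$\zeta_I=\frac{\mathbb{E}[I(1)I(2)]-\mathbb{E}[I(2)]^2}{\mathbb{E}[I(2)^2]-\mathbb{E}[I(2)]^2}$$ be the temporal interference correlation coefficient. Then the closest point $x_2$ exists and is almost surely unique; $r_2$ has the density $f(r)=2\lambda\pi r\,e^{-\lambda\pi r^2}$, $r\ge 0$; for each $k$ the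 sum $I(k)$ converges almost surely and has finite second moment; the denominator of $\zeta_I$ is positive; and $$\zeta_I=\frac{\lambda\int_{\mathbb{R}^2}g^2(x)\,dx-a+2\lambda\,\mathbb{E}\Big[g(x_2)\int_{B(0,r_2)}g(x)\,dx\Big]}{\mathbb{E}[h^2]\,\lambda\int_{\mathbb{R}^2}g^2(x)\,dx-b+2\lambda\,\mathbb{E}\Big[g(x_2)\int_{B(0,r_2)}g(x)\,dx\Big]},$$ where $a=\mathbb{E}[g^2(x_2)]+\mathbb{E}[g(x_2)]^2$ and $b=\mathbb{E}[h^2]\,\mathbb{E}[g^2(x_2)]+\mathbb{E}[g(x_2)]^2$. -/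

import Mathlib

open MeasureTheory ProbabilityTheory
open scoped NNReal ENNReal

noncomputable section

namespace CellularNetwork

/-- The Euclidean plane. -/
abbrev Plane : Type := EuclideanSpace ℝ (Fin 2)

/-- A random set `Φ` of points is a (simple) Poisson point process with intensity measure `Λ`: the
number of points in a measurable set `B` of finite `Λ`-measure is Poisson distributed with mean
`Λ B`, and the numbers of points in pairwise disjoint such sets are independent. -/
structure IsPoissonPointProcess {Ω S : Type*} [MeasurableSpace Ω] [MeasurableSpace S]
    (Λ : Measure S) (Φ : Ω → Set S) (P : Measure Ω) : Prop where
  count_law : ∀ B : Set S, MeasurableSet B → Λ B ≠ ∞ →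
    HasLaw (fun ω => (Φ ω ∩ B).encard)
      ((poissonMeasure (Λ B).toNNReal).map (fun n : ℕ => (n : ℕ∞))) P
  count_indep : ∀ (n : ℕ) (B : Fin n → Set S),
    (∀ j, MeasurableSet (B j)) → (∀ j, Λ (B j) ≠ ∞) → Pairwise (Function.onFun Disjoint B) →
    iIndepFun (fun j ω => (Φ ω ∩ B j).encard) P

/-- Law of the power gain of a Rayleigh fading link with unit mean power: exponential with
mean one. -/
def fadingLaw : Measure ℝ := expMeasure 1

/-- The base stations form a homogeneous Poisson point process of intensity `lam` in the plane,
with points listed without repetition as `X 0, X 1, …` (the process is almost surely infinite).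
`h i k` is the power gain of the link from the station `X i` to the user in time slot `k`; the
gains are Rayleigh with unit mean power, independent over stations and time slots, and
independent of the positions. -/
structure IsRayleighNetwork {Ω : Type*} [MeasurableSpace Ω] (lam : ℝ)
    (X : ℕ → Ω → Plane) (h : ℕ → Fin 2 → Ω → ℝ) (P : Measure Ω) : Prop where
  measurable_position : ∀ i, Measurable (X i)
  injective_position : ∀ᵐ ω ∂P, Function.Injective (fun i => X i ω)
  poisson : IsPoissonPointProcess (ENNReal.ofReal lam • (volume : Measure Plane))
    (fun ω => Set.range (fun i => X i ω)) P
  measurable_gain : ∀ i k, Measurable (h i k)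
  gain_law : ∀ i k, HasLaw (h i k) fadingLaw P
  gain_indep : iIndepFun (fun (p : ℕ × Fin 2) => h p.1 p.2) P
  gain_indep_position :
    IndepFun (fun ω (p : ℕ × Fin 2) => h p.1 p.2 ω) (fun ω (i : ℕ) => X i ω) P

/-- The bounded path-loss function `g(x) = 1 / (ε + ‖x‖ ^ α)`. -/
def pathLoss (ε α : ℝ) (x : Plane) : ℝ := 1 / (ε + ‖x‖ ^ α)

variable {Ω : Type*}

/-- The index of the station closest to the location `ℓ`. It is almost surely unique; ties are
broken in favour of the least index. -/
def servingIndex (X : ℕ → Ω → Plane) (ℓ : Plane) (ω : Ω) : ℕ :=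
  sInf {j | ∀ i, ‖X j ω - ℓ‖ ≤ ‖X i ω - ℓ‖}

/-- The position of the station that serves a user located at `ℓ`. -/
def servingStation (X : ℕ → Ω → Plane) (ℓ : Plane) (ω : Ω) : Plane :=
  X (servingIndex X ℓ ω) ω

/-- Power received at `ℓ` in time slot `k` from the station `i`, counted as interference: the
serving station does not contribute. -/
def interferencePower (ε α : ℝ) (X : ℕ → Ω → Plane) (h : ℕ → Fin 2 → Ω → ℝ)
    (k : Fin 2) (ℓ : Plane) (ω : Ω) (i : ℕ) : ℝ :=
  if i = servingIndex X ℓ ω then 0 else h i k ω * pathLoss ε α (X i ω - ℓ)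

/-- The interference power at `ℓ` in time slot `k`. -/
def interference (ε α : ℝ) (X : ℕ → Ω → Plane) (h : ℕ → Fin 2 → Ω → ℝ)
    (k : Fin 2) (ℓ : Plane) (ω : Ω) : ℝ :=
  ∑' i, interferencePower ε α X h k ℓ ω i

/-- The interference correlation coefficient `ζ_I(ℓ₁, ℓ₂)` of a user who is at `ℓ₁` in the first
time slot and at `ℓ₂` in the second. -/
def interferenceCorrelation [MeasurableSpace Ω] (P : Measure Ω) (ε α : ℝ)
    (X : ℕ → Ω → Plane) (h : ℕ → Fin 2 → Ω → ℝ) (ℓ₁ ℓ₂ : Plane) : ℝ :=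
  ((∫ ω, interference ε α X h 0 ℓ₁ ω * interference ε α X h 1 ℓ₂ ω ∂P)
      - (∫ ω, interference ε α X h 1 ℓ₂ ω ∂P) ^ 2) /
    ((∫ ω, interference ε α X h 1 ℓ₂ ω ^ 2 ∂P)
      - (∫ ω, interference ε α X h 1 ℓ₂ ω ∂P) ^ 2)

/-- The density `2 π lam r exp(-lam π r ^ 2)`, `r ≥ 0`, of the distance to the closest station. -/
def servingDistanceDensity (lam : ℝ) (r : ℝ) : ℝ :=
  if 0 ≤ r then 2 * lam * Real.pi * r * Real.exp (-lam * Real.pi * r ^ 2) else 0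

end CellularNetwork

end

open CellularNetwork

/-! Write `W` for the sum of `g` over the interfering stations, `V` for the sum of `g²` over them,
and `F₂ = g(x₂)`. The gains are independent of the positions, have mean 1 and second moment 2, and
are mutually independent. Integrating them out gives `E[I(k)] = E[W]`, `E[I(1)I(2)] = E[W²]` and
`E[I(k)²] = E[W²] + E[V]` (`lintegral_gainSum`, `lintegral_gainSum_mul_gainSum`). The denominator of
the coefficient is therefore `Var W + E[V]`, which is positive.

It remains to compute moments of `W = G - F₂`, where `G` is the sum of `g` over all stations.
Campbell's formula `lintegral_pointSum` gives `E[G]`, and also `E[V]` when applied to `g²`;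
`lintegral_pointSum_mul_pointSum` gives `E[G²]`. The cross moment `E[F₂ G]` is the only term that
sees the dependence between the serving station and the rest: given `r₂`, the other stations form a
Poisson process outside the ball of radius `r₂`. In mean form this is
`lintegral_servingStation_mul_pointSum`. It is proved without conditioning, by comparing two
measures on the tails `r₂ > t`: up to a null set, `r₂ > t` says that the closed ball of radius `t`
is empty, and this is independent of the points outside that ball.

Moments are computed in `ℝ≥0∞`, where sums and integrals commute freely, and turned into real
numbers at the end. -/

namespace CellularNetwork

/-! ### Moments of the Poisson distribution -/

lemma lintegral_poissonMeasure (r : ℝ≥0) (f : ℕ → ℝ≥0∞) :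
    ∫⁻ n, f n ∂(poissonMeasure r) =
      ∑' n : ℕ, ENNReal.ofReal (Real.exp (-r) * r ^ n / n.factorial) * f n := by
  simp [poissonMeasure, lintegral_sum_measure, lintegral_smul_measure]

/-- The size-bias identity: `n / n!` cancels to `1 / (n - 1)!` and the term `n = 0` vanishes. Taking
`f = 1` and `f = n` yields the first two moments. -/
lemma lintegral_poissonMeasure_cast_mul (r : ℝ≥0) (f : ℕ → ℝ≥0∞) :
    ∫⁻ n, (n : ℝ≥0∞) * f n ∂(poissonMeasure r) = r * ∫⁻ n, f (n + 1) ∂(poissonMeasure r) := by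
  rw [lintegral_poissonMeasure, lintegral_poissonMeasure, tsum_eq_zero_add' ENNReal.summable,
    ← ENNReal.tsum_mul_left]
  simp only [Nat.cast_zero, zero_mul, mul_zero, zero_add]
  refine tsum_congr fun n => ?_
  rw [← mul_assoc, ← mul_assoc, ← ENNReal.ofReal_natCast, ← ENNReal.ofReal_coe_nnreal (p := r),
    ← ENNReal.ofReal_mul (by positivity), ← ENNReal.ofReal_mul (by positivity)]
  congr 2
  rw [Nat.factorial_succ, pow_succ]
  push_cast
  field_simp

lemma lintegral_poissonMeasure_cast (r : ℝ≥0) :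
    ∫⁻ n, (n : ℝ≥0∞) ∂(poissonMeasure r) = r := by
  simpa using lintegral_poissonMeasure_cast_mul r (fun _ => 1)

lemma lintegral_poissonMeasure_cast_sq (r : ℝ≥0) :
    ∫⁻ n, (n : ℝ≥0∞) * n ∂(poissonMeasure r) = r * r + r := by
  rw [lintegral_poissonMeasure_cast_mul r (fun n => (n : ℝ≥0∞))]
  simp only [Nat.cast_add, Nat.cast_one]
  rw [lintegral_add_right _ measurable_const, lintegral_poissonMeasure_cast]
  simp [mul_add]

/-! ### Sums over the points of a point process -/

section PointSum

variable {Ω S : Type*}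

/-- The sum of `F` over the points `X 0 ω, X 1 ω, …`. -/
noncomputable def pointSum (X : ℕ → Ω → S) (F : S → ℝ≥0∞) (ω : Ω) : ℝ≥0∞ := ∑' i, F (X i ω)

/-- The number of the points `X 0 ω, X 1 ω, …` that lie in `B`. -/
noncomputable def pointCount (X : ℕ → Ω → S) (B : Set S) : Ω → ℝ≥0∞ :=
  pointSum X (B.indicator 1)

/-- The sum counts indices; injectivity of the enumeration rules out multiplicities. -/
lemma pointCount_eq_encard (X : ℕ → Ω → S) (B : Set S) {ω : Ω}
    (hinj : Function.Injective (fun i => X i ω)) :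
    pointCount X B ω = ((Set.range (fun i => X i ω) ∩ B).encard : ℝ≥0∞) := by
  classical
  have h1 : (Set.range (fun i => X i ω) ∩ B) = (fun i => X i ω) '' {i | X i ω ∈ B} := by
    ext y
    constructor
    · rintro ⟨⟨i, rfl⟩, hi⟩
      exact ⟨i, hi, rfl⟩
    · rintro ⟨i, hi, rfl⟩
      exact ⟨⟨i, rfl⟩, hi⟩
  rw [h1, hinj.encard_image, ← ENNReal.tsum_set_one, tsum_subtype {i | X i ω ∈ B} (fun _ => 1)]
  rfl

lemma pointCount_eq_zero_iff (X : ℕ → Ω → S) (B : Set S) (ω : Ω) :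
    pointCount X B ω = 0 ↔ ∀ i, X i ω ∉ B := by
  simp [pointCount, pointSum]

lemma pointCount_disjoint_union (X : ℕ → Ω → S) {A B : Set S} (hAB : Disjoint A B) (ω : Ω) :
    pointCount X (A ∪ B) ω = pointCount X A ω + pointCount X B ω := by
  unfold pointCount pointSum
  rw [← ENNReal.tsum_add]
  refine tsum_congr fun i => ?_
  rw [Set.indicator_union_of_disjoint hAB]

variable [MeasurableSpace Ω] [MeasurableSpace S]

lemma measurable_pointSum {X : ℕ → Ω → S} (hX : ∀ i, Measurable (X i)) {F : S → ℝ≥0∞}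
    (hF : Measurable F) : Measurable (pointSum X F) :=
  Measurable.tsum fun i => hF.comp (hX i)

lemma measurable_pointCount {X : ℕ → Ω → S} (hX : ∀ i, Measurable (X i)) {B : Set S}
    (hB : MeasurableSet B) : Measurable (pointCount X B) :=
  measurable_pointSum hX (measurable_one.indicator hB)

/-- Two measures coincide if they agree on the sets of finite measure of a `σ`-finite measure. -/
lemma measure_ext_of_finite_sets (Λ : Measure S) [SigmaFinite Λ] {μ ν : Measure S}
    (h : ∀ B, MeasurableSet B → Λ B ≠ ∞ → μ B = ν B) : μ = ν := by
  refine Measure.ext_of_iUnion_eq_univ (iUnion_spanningSets Λ) fun i => ?_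
  ext B hB
  rw [Measure.restrict_apply hB, Measure.restrict_apply hB]
  refine h _ (hB.inter (measurableSet_spanningSets Λ i)) ?_
  exact ((measure_mono Set.inter_subset_right).trans_lt (measure_spanningSets_lt_top Λ i)).ne

/-- A weighted Campbell formula is determined by the weighted mean number of points. -/
lemma lintegral_mul_pointSum (Λ : Measure S) [SigmaFinite Λ] {P : Measure Ω} {X : ℕ → Ω → S}
    (hX : ∀ i, Measurable (X i)) {w : Ω → ℝ≥0∞} (hw : AEMeasurable w P) (κ : Measure S)
    (h : ∀ B, MeasurableSet B → Λ B ≠ ∞ → ∫⁻ ω, w ω * pointCount X B ω ∂P = κ B)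
    {F : S → ℝ≥0∞} (hF : Measurable F) :
    ∫⁻ ω, w ω * pointSum X F ω ∂P = ∫⁻ x, F x ∂κ := by
  -- The weighted mean measure of the points is the sum over `i` of the laws of `X i` under `w · P`.
  -- The hypothesis identifies it with `κ` on sets of finite `Λ`-measure.
  have key : ∀ F : S → ℝ≥0∞, Measurable F → ∫⁻ ω, w ω * pointSum X F ω ∂P =
      ∫⁻ x, F x ∂(Measure.sum fun i => (P.withDensity w).map (X i)) := by
    intro F hF
    rw [lintegral_sum_measure]
    have : ∀ i, ∫⁻ x, F x ∂((P.withDensity w).map (X i)) = ∫⁻ ω, w ω * F (X i ω) ∂P := by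
      intro i
      rw [lintegral_map hF (hX i)]
      exact lintegral_withDensity_eq_lintegral_mul₀ hw (hF.comp (hX i)).aemeasurable
    simp_rw [this]
    have hm : ∀ i, AEMeasurable (fun ω => w ω * F (X i ω)) P := fun i =>
      hw.mul (hF.comp (hX i)).aemeasurable
    rw [← lintegral_tsum hm]
    simp_rw [ENNReal.tsum_mul_left]
    rfl
  rw [key F hF]
  congr 1
  refine measure_ext_of_finite_sets Λ fun B hB hΛ => ?_
  rw [← h B hB hΛ, pointCount, key _ (measurable_one.indicator hB), lintegral_indicator_one hB]

end PointSum

/-! ### Moments of a Poisson point process -/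

section Poisson

variable {Ω S : Type*} [MeasurableSpace Ω] {P : Measure Ω} {X : ℕ → Ω → S}

lemma ae_pointCount_eq (hinj : ∀ᵐ ω ∂P, Function.Injective (fun i => X i ω)) (B : Set S) :
    pointCount X B =ᵐ[P] fun ω => ((Set.range (fun i => X i ω) ∩ B).encard : ℝ≥0∞) := by
  filter_upwards [hinj] with ω hω using pointCount_eq_encard X B hω

variable [MeasurableSpace S] {Λ : Measure S}

/-- The law of the number of points in a set of finite intensity. -/
lemma lintegral_comp_pointCount (hinj : ∀ᵐ ω ∂P, Function.Injective (fun i => X i ω))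
    (hpoi : IsPoissonPointProcess Λ (fun ω => Set.range (fun i => X i ω)) P)
    {B : Set S} (hB : MeasurableSet B) (hΛ : Λ B ≠ ∞) {f : ℝ≥0∞ → ℝ≥0∞} :
    ∫⁻ ω, f (pointCount X B ω) ∂P = ∫⁻ n : ℕ, f n ∂(poissonMeasure (Λ B).toNNReal) := by
  have h1 := hpoi.count_law B hB hΛ
  calc ∫⁻ ω, f (pointCount X B ω) ∂P
      = ∫⁻ ω, (fun n : ℕ∞ => f (n : ℝ≥0∞)) (Set.range (fun i => X i ω) ∩ B).encard ∂P := by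
        refine lintegral_congr_ae ?_
        filter_upwards [ae_pointCount_eq hinj B] with ω hω
        rw [hω]
    _ = ∫⁻ n : ℕ, f n ∂(poissonMeasure (Λ B).toNNReal) := by
        -- Discreteness of `ℕ∞` makes any `f` admissible, with no measurability assumption.
        rw [← lintegral_map' (f := fun n : ℕ∞ => f (n : ℝ≥0∞))
          (Measurable.of_discrete.aemeasurable) h1.aemeasurable, h1.map_eq,
          lintegral_map Measurable.of_discrete Measurable.of_discrete]
        simp

lemma lintegral_pointCount (hinj : ∀ᵐ ω ∂P, Function.Injective (fun i => X i ω))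
    (hpoi : IsPoissonPointProcess Λ (fun ω => Set.range (fun i => X i ω)) P)
    {B : Set S} (hB : MeasurableSet B) (hΛ : Λ B ≠ ∞) :
    ∫⁻ ω, pointCount X B ω ∂P = Λ B := by
  rw [lintegral_comp_pointCount hinj hpoi hB hΛ (f := fun x => x), lintegral_poissonMeasure_cast,
    ENNReal.coe_toNNReal hΛ]

lemma lintegral_pointCount_sq (hinj : ∀ᵐ ω ∂P, Function.Injective (fun i => X i ω))
    (hpoi : IsPoissonPointProcess Λ (fun ω => Set.range (fun i => X i ω)) P)
    {B : Set S} (hB : MeasurableSet B) (hΛ : Λ B ≠ ∞) :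
    ∫⁻ ω, pointCount X B ω * pointCount X B ω ∂P = Λ B * Λ B + Λ B := by
  rw [lintegral_comp_pointCount hinj hpoi hB hΛ (f := fun x => x * x),
    lintegral_poissonMeasure_cast_sq, ENNReal.coe_toNNReal hΛ]

/-- The probability that a set of finite intensity contains no point. -/
lemma measure_pointCount_eq_zero (hX : ∀ i, Measurable (X i))
    (hinj : ∀ᵐ ω ∂P, Function.Injective (fun i => X i ω))
    (hpoi : IsPoissonPointProcess Λ (fun ω => Set.range (fun i => X i ω)) P)
    {B : Set S} (hB : MeasurableSet B) (hΛ : Λ B ≠ ∞) :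
    P {ω | pointCount X B ω = 0} = ENNReal.ofReal (Real.exp (-(Λ B).toReal)) := by
  have hm : MeasurableSet {ω | pointCount X B ω = 0} :=
    measurable_pointCount hX hB (measurableSet_singleton 0)
  have h := lintegral_comp_pointCount hinj hpoi hB hΛ
    (f := (({0} : Set ℝ≥0∞).indicator 1))
  rw [← lintegral_indicator_one hm]
  refine Eq.trans ?_ (h.trans ?_)
  · rfl
  · rw [lintegral_poissonMeasure, tsum_eq_single 0]
    · simp [ENNReal.toReal]
    · intro n hn
      simp [hn]

/-- The numbers of points in disjoint sets are independent. -/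
lemma indepFun_pointCount (hinj : ∀ᵐ ω ∂P, Function.Injective (fun i => X i ω))
    (hpoi : IsPoissonPointProcess Λ (fun ω => Set.range (fun i => X i ω)) P)
    {A B : Set S} (hA : MeasurableSet A) (hB : MeasurableSet B) (hΛA : Λ A ≠ ∞) (hΛB : Λ B ≠ ∞)
    (hAB : Disjoint A B) : IndepFun (pointCount X A) (pointCount X B) P := by
  have h := hpoi.count_indep 2 ![A, B] (by intro j; fin_cases j <;> simpa)
    (by intro j; fin_cases j <;> simpa)
    (by
      intro i j hij
      fin_cases i <;> fin_cases j <;> simp_all [Function.onFun, hAB.symm])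
  have h2 := h.indepFun (i := 0) (j := 1) (by simp)
  have h3 := h2.comp (φ := fun n : ℕ∞ => (n : ℝ≥0∞)) (ψ := fun n : ℕ∞ => (n : ℝ≥0∞))
    Measurable.of_discrete Measurable.of_discrete
  exact h3.congr (ae_pointCount_eq hinj A).symm (ae_pointCount_eq hinj B).symm

lemma lintegral_pointCount_mul_of_disjoint (hX : ∀ i, Measurable (X i))
    (hinj : ∀ᵐ ω ∂P, Function.Injective (fun i => X i ω))
    (hpoi : IsPoissonPointProcess Λ (fun ω => Set.range (fun i => X i ω)) P)
    {A B : Set S} (hA : MeasurableSet A) (hB : MeasurableSet B) (hΛA : Λ A ≠ ∞) (hΛB : Λ B ≠ ∞)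
    (hAB : Disjoint A B) {f : ℝ≥0∞ → ℝ≥0∞} (hf : Measurable f) :
    ∫⁻ ω, f (pointCount X A ω) * pointCount X B ω ∂P =
      (∫⁻ ω, f (pointCount X A ω) ∂P) * Λ B := by
  rw [← lintegral_pointCount hinj hpoi hB hΛB]
  exact lintegral_mul_eq_lintegral_mul_lintegral_of_indepFun
    (hf.comp (measurable_pointCount hX hA)) (measurable_pointCount hX hB)
    ((indepFun_pointCount hinj hpoi hA hB hΛA hΛB hAB).comp hf measurable_id)

/-- Split `A` and `B` along `A ∩ B`: counts of disjoint pieces are independent, so only the square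
of the count in `A ∩ B` adds a term beyond the product of means. -/
lemma lintegral_pointCount_mul (hX : ∀ i, Measurable (X i))
    (hinj : ∀ᵐ ω ∂P, Function.Injective (fun i => X i ω))
    (hpoi : IsPoissonPointProcess Λ (fun ω => Set.range (fun i => X i ω)) P)
    {A B : Set S} (hA : MeasurableSet A) (hB : MeasurableSet B) (hΛA : Λ A ≠ ∞)
    (hΛB : Λ B ≠ ∞) :
    ∫⁻ ω, pointCount X A ω * pointCount X B ω ∂P = Λ A * Λ B + Λ (A ∩ B) := by
  have hdA : Disjoint (A \ B) (A ∩ B) := Set.disjoint_sdiff_inter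
  have hdB : Disjoint (B \ A) (A ∩ B) := by rw [Set.inter_comm]; exact Set.disjoint_sdiff_inter
  have hd : Disjoint (A \ B) (B \ A) := disjoint_sdiff_sdiff
  have hmA := hA.diff hB
  have hmB := hB.diff hA
  have hmI := hA.inter hB
  have hfA : Λ (A \ B) ≠ ∞ := ne_top_of_le_ne_top hΛA (measure_mono Set.sdiff_subset)
  have hfB : Λ (B \ A) ≠ ∞ := ne_top_of_le_ne_top hΛB (measure_mono Set.sdiff_subset)
  have hfI : Λ (A ∩ B) ≠ ∞ := ne_top_of_le_ne_top hΛA (measure_mono Set.inter_subset_left)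
  have hcA : ∀ ω, pointCount X A ω = pointCount X (A \ B) ω + pointCount X (A ∩ B) ω := by
    intro ω
    rw [← pointCount_disjoint_union X hdA, Set.sdiff_union_inter]
  have hcB : ∀ ω, pointCount X B ω = pointCount X (B \ A) ω + pointCount X (A ∩ B) ω := by
    intro ω
    rw [← pointCount_disjoint_union X hdB, Set.inter_comm, Set.sdiff_union_inter]
  have hLA : Λ A = Λ (A \ B) + Λ (A ∩ B) := by
    rw [← measure_union hdA hmI, Set.sdiff_union_inter]
  have hLB : Λ B = Λ (B \ A) + Λ (A ∩ B) := by
    rw [← measure_union hdB hmI, Set.inter_comm, Set.sdiff_union_inter]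
  have mA := measurable_pointCount hX hmA
  have mB := measurable_pointCount hX hmB
  have mI := measurable_pointCount hX hmI
  have e1 : ∀ ω, pointCount X A ω * pointCount X B ω =
      pointCount X (A \ B) ω * pointCount X (B \ A) ω +
      pointCount X (A \ B) ω * pointCount X (A ∩ B) ω +
      pointCount X (B \ A) ω * pointCount X (A ∩ B) ω +
      pointCount X (A ∩ B) ω * pointCount X (A ∩ B) ω := by
    intro ω
    rw [hcA, hcB]
    ring
  have i1 := lintegral_pointCount_mul_of_disjoint hX hinj hpoi hmA hmB hfA hfB hd measurable_id
  have i2 := lintegral_pointCount_mul_of_disjoint hX hinj hpoi hmA hmI hfA hfI hdA measurable_id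
  have i3 := lintegral_pointCount_mul_of_disjoint hX hinj hpoi hmB hmI hfB hfI hdB measurable_id
  simp only [id_eq, lintegral_pointCount hinj hpoi hmA hfA,
    lintegral_pointCount hinj hpoi hmB hfB] at i1 i2 i3
  have mul_meas : ∀ {f g : Ω → ℝ≥0∞}, Measurable f → Measurable g →
    Measurable fun ω => f ω * g ω := fun hf hg => hf.mul hg
  simp_rw [e1]
  rw [lintegral_add_right _ (mul_meas mI mI), lintegral_add_right _ (mul_meas mB mI),
    lintegral_add_right _ (mul_meas mA mI), i1, i2, i3, lintegral_pointCount_sq hinj hpoi hmI hfI,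
    hLA, hLB]
  ring

variable [SigmaFinite Λ]

/-- Campbell's formula. -/
lemma lintegral_pointSum (hX : ∀ i, Measurable (X i))
    (hinj : ∀ᵐ ω ∂P, Function.Injective (fun i => X i ω))
    (hpoi : IsPoissonPointProcess Λ (fun ω => Set.range (fun i => X i ω)) P)
    {F : S → ℝ≥0∞} (hF : Measurable F) :
    ∫⁻ ω, pointSum X F ω ∂P = ∫⁻ x, F x ∂Λ := by
  simpa using lintegral_mul_pointSum Λ hX (w := fun _ => 1) aemeasurable_const Λ
    (fun B hB hΛ => by simpa using lintegral_pointCount hinj hpoi hB hΛ) hF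

/-- The second moment formula for sums over a Poisson point process. -/
lemma lintegral_pointSum_mul_pointSum (hX : ∀ i, Measurable (X i))
    (hinj : ∀ᵐ ω ∂P, Function.Injective (fun i => X i ω))
    (hpoi : IsPoissonPointProcess Λ (fun ω => Set.range (fun i => X i ω)) P)
    {F G : S → ℝ≥0∞} (hF : Measurable F) (hG : Measurable G) :
    ∫⁻ ω, pointSum X F ω * pointSum X G ω ∂P =
      (∫⁻ x, F x ∂Λ) * (∫⁻ x, G x ∂Λ) + ∫⁻ x, F x * G x ∂Λ := by
  -- Extend from sets to functions one factor at a time: here the first factor is still a count,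
  -- serving as the weight. Afterwards the sum of `G` becomes the weight.
  have step : ∀ A, MeasurableSet A → Λ A ≠ ∞ →
      ∫⁻ ω, pointCount X A ω * pointSum X G ω ∂P =
        ∫⁻ x, G x ∂(Λ A • Λ + Λ.restrict A) := by
    intro A hA hΛA
    refine lintegral_mul_pointSum Λ hX (measurable_pointCount hX hA).aemeasurable _ ?_ hG
    intro B hB hΛB
    rw [lintegral_pointCount_mul hX hinj hpoi hA hB hΛA hΛB]
    simp [Measure.restrict_apply hB, Set.inter_comm]
  have h2 : ∫⁻ ω, pointSum X G ω * pointSum X F ω ∂P =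
      ∫⁻ x, F x ∂((∫⁻ x, G x ∂Λ) • Λ + Λ.withDensity G) := by
    refine lintegral_mul_pointSum Λ hX (measurable_pointSum hX hG).aemeasurable _ ?_ hF
    intro A hA hΛA
    simp_rw [mul_comm (pointSum X G _)]
    rw [step A hA hΛA, lintegral_add_measure, lintegral_smul_measure]
    simp [withDensity_apply _ hA, mul_comm]
  simp_rw [mul_comm (pointSum X F _)]
  rw [h2, lintegral_add_measure, lintegral_smul_measure,
    lintegral_withDensity_eq_lintegral_mul _ hG hF]
  simp [mul_comm]

/-- On the event that `D` contains no point, the points outside `D` have the same mean measure as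
without conditioning. -/
lemma setLIntegral_pointSum_of_pointCount_eq_zero (hX : ∀ i, Measurable (X i))
    (hinj : ∀ᵐ ω ∂P, Function.Injective (fun i => X i ω))
    (hpoi : IsPoissonPointProcess Λ (fun ω => Set.range (fun i => X i ω)) P)
    {D : Set S} (hD : MeasurableSet D) (hΛD : Λ D ≠ ∞) {F : S → ℝ≥0∞} (hF : Measurable F) :
    ∫⁻ ω in {ω | pointCount X D ω = 0}, pointSum X F ω ∂P =
      P {ω | pointCount X D ω = 0} * ∫⁻ x in Dᶜ, F x ∂Λ := by
  have hm : MeasurableSet {ω | pointCount X D ω = 0} :=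
    measurable_pointCount hX hD (measurableSet_singleton 0)
  set f : ℝ≥0∞ → ℝ≥0∞ := ({0} : Set ℝ≥0∞).indicator 1 with hf
  have hfm : Measurable f := measurable_one.indicator (measurableSet_singleton 0)
  have hp : ∫⁻ ω, f (pointCount X D ω) ∂P = P {ω | pointCount X D ω = 0} :=
    lintegral_indicator_one hm
  have hw : ∀ ω, ∀ G : Ω → ℝ≥0∞, f (pointCount X D ω) * G ω =
      {ω | pointCount X D ω = 0}.indicator G ω := by
    intro ω G
    by_cases h0 : pointCount X D ω = 0 <;> simp [hf, h0]
  rw [← lintegral_indicator hm]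
  simp_rw [← hw]
  rw [lintegral_mul_pointSum Λ hX (w := fun ω => f (pointCount X D ω))
    (hfm.comp (measurable_pointCount hX hD)).aemeasurable
    (P {ω | pointCount X D ω = 0} • Λ.restrict Dᶜ) _ hF, lintegral_smul_measure, smul_eq_mul]
  intro B hB hΛB
  -- When `D` is empty of points, the counts in `B` and `B \ D` agree, and the latter is independent
  -- of the count in `D`.
  have hΛ' : Λ (B \ D) ≠ ∞ := ne_top_of_le_ne_top hΛB (measure_mono Set.sdiff_subset)
  have key := lintegral_pointCount_mul_of_disjoint hX hinj hpoi hD (hB.diff hD) hΛD hΛ'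
    Set.disjoint_sdiff_right hfm
  rw [hp] at key
  simp only [Measure.smul_apply, Measure.restrict_apply hB, smul_eq_mul]
  rw [← Set.sdiff_eq, ← key]
  refine lintegral_congr fun ω => ?_
  by_cases h0 : pointCount X D ω = 0
  · have hnot := (pointCount_eq_zero_iff X D ω).1 h0
    congr 1
    refine tsum_congr fun i => ?_
    by_cases hi : X i ω ∈ B <;> simp [hi, hnot i]
  · simp [hf, h0]

/-- If the level sets of `f` are null sets of the intensity, then no two points of the process have
the same value of `f`. -/
lemma ae_injective_comp (hX : ∀ i, Measurable (X i))
    (hinj : ∀ᵐ ω ∂P, Function.Injective (fun i => X i ω))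
    (hpoi : IsPoissonPointProcess Λ (fun ω => Set.range (fun i => X i ω)) P)
    {f : S → ℝ} (hf : Measurable f) (hnull : ∀ c, Λ {x | f x = c} = 0) :
    ∀ᵐ ω ∂P, Function.Injective (fun i => f (X i ω)) := by
  classical
  have hpair : ∀ p : ℕ × ℕ, Measurable fun ω => (X p.1 ω, X p.2 ω) := fun p =>
    (hX p.1).prodMk (hX p.2)
  -- The second moment measure of the process, diagonal pairs included. On `D ×ˢ D` it is the
  -- product measure plus the image of `Λ` on the diagonal.
  set M : Measure (S × S) := Measure.sum fun p : ℕ × ℕ => P.map fun ω => (X p.1 ω, X p.2 ω)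
    with hM
  have hMapply : ∀ C, MeasurableSet C → M C = ∑' i, ∑' j, P {ω | (X i ω, X j ω) ∈ C} := by
    intro C hC
    rw [hM, Measure.sum_apply _ hC, ← ENNReal.tsum_prod
      (f := fun i j => P {ω | (X i ω, X j ω) ∈ C})]
    refine tsum_congr fun p => ?_
    rw [Measure.map_apply (hpair p) hC]
    rfl
  have hrect : ∀ A B, MeasurableSet A → MeasurableSet B → Λ A ≠ ∞ → Λ B ≠ ∞ →
      M (A ×ˢ B) = Λ A * Λ B + Λ (A ∩ B) := by
    intro A B hA hB hΛA hΛB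
    have hi : ∀ i, Measurable fun ω => A.indicator (1 : S → ℝ≥0∞) (X i ω) := fun i =>
      (measurable_one.indicator hA).comp (hX i)
    have hj : ∀ i, Measurable fun ω => B.indicator (1 : S → ℝ≥0∞) (X i ω) := fun i =>
      (measurable_one.indicator hB).comp (hX i)
    rw [← lintegral_pointCount_mul hX hinj hpoi hA hB hΛA hΛB, hMapply _ (hA.prod hB)]
    simp_rw [pointCount, pointSum, ← ENNReal.tsum_mul_right, ← ENNReal.tsum_mul_left]
    have hij : ∀ i j, Measurable fun ω =>
        A.indicator (1 : S → ℝ≥0∞) (X i ω) * B.indicator (1 : S → ℝ≥0∞) (X j ω) :=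
      fun i j => (hi i).mul (hj j)
    rw [lintegral_tsum fun i => (Measurable.tsum (hij i)).aemeasurable]
    refine tsum_congr fun i => ?_
    rw [lintegral_tsum fun j => (hij i j).aemeasurable]
    refine tsum_congr fun j => ?_
    have hm : MeasurableSet {ω | (X i ω, X j ω) ∈ A ×ˢ B} := hpair (i, j) (hA.prod hB)
    rw [← lintegral_indicator_one hm]
    refine lintegral_congr fun ω => ?_
    by_cases h1 : X i ω ∈ A <;> by_cases h2 : X j ω ∈ B <;> simp [h1, h2]
  have key : ∀ D, MeasurableSet D → Λ D ≠ ∞ → ∀ i j, i ≠ j →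
      P {ω | X i ω ∈ D ∧ X j ω ∈ D ∧ f (X i ω) = f (X j ω)} = 0 := by
    intro D hD hΛD
    have : IsFiniteMeasure (Λ.restrict D) := ⟨by simpa [lt_top_iff_ne_top] using hΛD⟩
    have hdiag : Measurable fun x : S => (x, x) := measurable_id.prodMk measurable_id
    have hMD : M.restrict (D ×ˢ D) = (Λ.restrict D).prod (Λ.restrict D) +
        (Λ.restrict D).map fun x => (x, x) := by
      symm
      refine Measure.ext_prod fun {A B} hA hB => ?_
      have hfA : Λ (A ∩ D) ≠ ∞ := ne_top_of_le_ne_top hΛD (measure_mono Set.inter_subset_right)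
      have hfB : Λ (B ∩ D) ≠ ∞ := ne_top_of_le_ne_top hΛD (measure_mono Set.inter_subset_right)
      rw [Measure.restrict_apply (hA.prod hB), Set.prod_inter_prod,
        hrect _ _ (hA.inter hD) (hB.inter hD) hfA hfB, Measure.add_apply, Measure.prod_prod,
        Measure.map_apply hdiag (hA.prod hB), Measure.restrict_apply hA, Measure.restrict_apply hB,
        Measure.restrict_apply (hdiag (hA.prod hB))]
      congr 2
      ext x
      simp
      tauto
    set T : Set (S × S) := {p | f p.1 = f p.2} with hT
    have hTm : MeasurableSet T :=
      measurableSet_eq_fun (hf.comp measurable_fst) (hf.comp measurable_snd)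
    -- By Fubini, since each slice of the tie set `T` is a level set of `f`. Hence `M` charges `T`
    -- only through the diagonal, with total mass `Λ D`.
    have hprod : (Λ.restrict D).prod (Λ.restrict D) T = 0 := by
      rw [Measure.measure_prod_null hTm]
      refine Filter.Eventually.of_forall fun x => ?_
      refine le_antisymm ((Measure.restrict_apply_le D _).trans ?_) zero_le
      refine (measure_mono ?_).trans (hnull (f x)).le
      intro y hy
      exact Eq.symm hy
    have hMT : M (T ∩ D ×ˢ D) = Λ D := by
      rw [← Measure.restrict_apply hTm, hMD, Measure.add_apply, hprod, zero_add,
        Measure.map_apply hdiag hTm]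
      have : (fun x : S => (x, x)) ⁻¹' T = Set.univ := by ext x; simp [hT]
      simp [this]
    have hsum : ∑' i, P {ω | X i ω ∈ D} = Λ D := by
      rw [← lintegral_pointCount hinj hpoi hD hΛD]
      unfold pointCount pointSum
      have hm : ∀ i, Measurable fun ω => D.indicator (1 : S → ℝ≥0∞) (X i ω) := fun i =>
        (measurable_one.indicator hD).comp (hX i)
      rw [lintegral_tsum fun i => (hm i).aemeasurable]
      refine tsum_congr fun i => ?_
      exact (lintegral_indicator_one ((hX i) hD)).symm
    -- The pairs `i = j` already account for the whole mass `Λ D`. As this mass is finite it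
    -- cancels, leaving probability zero for every tie between distinct indices.
    set o : ℕ → ℕ → ℝ≥0∞ := fun i j => if j = i then 0 else
      P {ω | X i ω ∈ D ∧ X j ω ∈ D ∧ f (X i ω) = f (X j ω)} with ho
    have hsplit : M (T ∩ D ×ˢ D) = ∑' i, P {ω | X i ω ∈ D} + ∑' i, ∑' j, o i j := by
      rw [hMapply _ (hTm.inter (hD.prod hD)), ← ENNReal.tsum_add]
      refine tsum_congr fun i => ?_
      rw [← tsum_ite_eq i (fun _ => P {ω | X i ω ∈ D}), ← ENNReal.tsum_add]
      refine tsum_congr fun j => ?_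
      by_cases hij : j = i
      · subst hij
        simp [ho, hT]
      · simp only [ho, hij, if_false, zero_add, hT]
        congr 1
        ext ω
        simp
        tauto
    rw [hMT, hsum] at hsplit
    have hzero : ∑' i, ∑' j, o i j = 0 :=
      (ENNReal.add_right_inj hΛD).1 (by rw [← hsplit, add_zero])
    intro i j hij
    have := ENNReal.tsum_eq_zero.1 (ENNReal.tsum_eq_zero.1 hzero i) j
    simpa [ho, hij.symm] using this
  have hall : ∀ᵐ ω ∂P, ∀ n i j, i ≠ j →
      ¬ (X i ω ∈ spanningSets Λ n ∧ X j ω ∈ spanningSets Λ n ∧ f (X i ω) = f (X j ω)) := by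
    rw [ae_all_iff]; intro n
    rw [ae_all_iff]; intro i
    rw [ae_all_iff]; intro j
    by_cases hij : i = j
    · exact Filter.Eventually.of_forall fun ω h => absurd hij h
    · have := key _ (measurableSet_spanningSets Λ n) (measure_spanningSets_lt_top Λ n).ne i j hij
      filter_upwards [measure_eq_zero_iff_ae_notMem.1 this] with ω hω _ using hω
  filter_upwards [hall] with ω hω i j hij
  by_contra hne
  have hmem : ∀ x : S, ∃ n, x ∈ spanningSets Λ n := fun x => ⟨_, mem_spanningSetsIndex Λ x⟩
  obtain ⟨m, hm⟩ := hmem (X i ω)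
  obtain ⟨n, hn⟩ := hmem (X j ω)
  exact hω (max m n) i j hne ⟨monotone_spanningSets Λ (le_max_left m n) hm,
    monotone_spanningSets Λ (le_max_right m n) hn, hij⟩

end Poisson

/-! ### Measures on the line -/

/-- Half-open intervals are differences of tails; the tails of `ν` inherit finiteness from those of
`μ`. -/
lemma measure_ext_of_Ioi {μ ν : Measure ℝ} [IsFiniteMeasure μ]
    (h : ∀ t, μ (Set.Ioi t) = ν (Set.Ioi t)) : μ = ν := by
  refine Measure.ext_of_Ioc' μ ν (fun a b _ => measure_ne_top μ _) fun a b hab => ?_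
  have hsub : Set.Ioi b ⊆ Set.Ioi a := Set.Ioi_subset_Ioi hab.le
  have hb : ν (Set.Ioi b) ≠ ∞ := h b ▸ measure_ne_top μ _
  rw [← Set.Ioi_sdiff_Ioi, measure_sdiff hsub measurableSet_Ioi.nullMeasurableSet
    (measure_ne_top μ _), measure_sdiff hsub measurableSet_Ioi.nullMeasurableSet hb, h, h]

/-- The measure of an interval under a density given by the derivative of `G` on the half-line. -/
lemma withDensity_half_line_Ioc {d G : ℝ → ℝ} (hd : Continuous d)
    (hG : ∀ r, HasDerivAt G (d r) r) (hd0 : ∀ r, 0 ≤ r → 0 ≤ d r) {a b : ℝ} (hab : a ≤ b) :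
    (volume.withDensity fun r => ENNReal.ofReal (if 0 ≤ r then d r else 0)) (Set.Ioc a b) =
      ENNReal.ofReal (G (max b 0) - G (max a 0)) := by
  have hab' : max a 0 ≤ max b 0 := max_le_max_right 0 hab
  have hint : IntegrableOn d (Set.Ioc (max a 0) (max b 0)) :=
    (hd.integrableOn_Icc).mono_set Set.Ioc_subset_Icc_self
  rw [withDensity_apply _ measurableSet_Ioc, ← intervalIntegral.integral_eq_sub_of_hasDerivAt
    (fun r _ => hG r) (hd.intervalIntegrable _ _), intervalIntegral.integral_of_le hab',
    ofReal_integral_eq_lintegral_ofReal hint, ← lintegral_indicator measurableSet_Ioc,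
    ← lintegral_indicator measurableSet_Ioc]
  · refine lintegral_congr_ae ?_
    -- For `a < 0 ≤ b` the point `0` lies in `Ioc a b` but not in the truncated interval, so this
    -- null point is discarded.
    filter_upwards [compl_mem_ae_iff.2 (measure_singleton (μ := volume) (0 : ℝ))] with r hr
    have hr0 : r ≠ 0 := hr
    by_cases h0 : 0 ≤ r
    · have h1 : 0 < r := lt_of_le_of_ne h0 hr0.symm
      have : r ∈ Set.Ioc (max a 0) (max b 0) ↔ r ∈ Set.Ioc a b := by
        simp [h1, h1.not_ge]
      by_cases hm : r ∈ Set.Ioc a b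
      · rw [Set.indicator_of_mem hm, Set.indicator_of_mem (this.2 hm), if_pos h0]
      · rw [Set.indicator_of_notMem hm, Set.indicator_of_notMem (fun h => hm (this.1 h))]
    · have : r ∉ Set.Ioc (max a 0) (max b 0) := fun h =>
        h0 ((le_max_right a 0).trans h.1.le)
      rw [Set.indicator_of_notMem this]
      by_cases hm : r ∈ Set.Ioc a b <;> simp [hm, h0]
  · filter_upwards [ae_restrict_mem measurableSet_Ioc] with r hr
    exact hd0 r ((le_max_right a 0).trans hr.1.le)

/-- The truncation `max t 0` covers negative radii, whose balls are empty. -/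
lemma volume_closedBall_plane (t : ℝ) :
    volume (Metric.closedBall (0 : Plane) t) = ENNReal.ofReal (Real.pi * max t 0 ^ 2) := by
  rw [EuclideanSpace.volume_closedBall_fin_two, mul_comm, ENNReal.ofReal_mul Real.pi_nonneg,
    ENNReal.ofReal_pow (le_max_right t 0)]
  congr 2
  simp

/-- Polar coordinates for radial functions on the plane. -/
lemma map_norm_volume_plane : (volume : Measure Plane).map (fun x => ‖x‖) =
    volume.withDensity fun r => ENNReal.ofReal (if 0 ≤ r then 2 * Real.pi * r else 0) := by
  have hcb : ∀ t : ℝ, (fun x : Plane => ‖x‖) ⁻¹' Set.Iic t = Metric.closedBall 0 t := by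
    intro t
    ext x
    simp
  have hIoc : ∀ a b : ℝ, a ≤ b → (volume : Measure Plane).map (fun x => ‖x‖) (Set.Ioc a b) =
      ENNReal.ofReal (Real.pi * max b 0 ^ 2 - Real.pi * max a 0 ^ 2) := by
    intro a b hab
    have hsub : Metric.closedBall (0 : Plane) a ⊆ Metric.closedBall 0 b :=
      Metric.closedBall_subset_closedBall hab
    rw [Measure.map_apply measurable_norm measurableSet_Ioc, ← Set.Iic_sdiff_Iic,
      Set.preimage_sdiff, hcb, hcb, measure_sdiff hsub measurableSet_closedBall.nullMeasurableSet
      (by rw [volume_closedBall_plane]; exact ENNReal.ofReal_ne_top), volume_closedBall_plane,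
      volume_closedBall_plane, ENNReal.ofReal_sub _ (by positivity)]
  refine Measure.ext_of_Ioc' _ _ (fun a b hab => ?_) fun a b hab => ?_
  · rw [hIoc a b hab.le]
    exact ENNReal.ofReal_ne_top
  · rw [hIoc a b hab.le, withDensity_half_line_Ioc (G := fun r => Real.pi * r ^ 2) (by fun_prop)
      (fun r => ?_) (fun r hr => by positivity) hab.le]
    have := ((hasDerivAt_id r).pow 2).const_mul Real.pi
    simp only [id_eq] at this
    convert! this using 1
    norm_num
    ring

/-! ### The serving station -/

section Serving

lemma servingIndex_mem {Ω : Type*} {X : ℕ → Ω → Plane} {ℓ : Plane} {ω : Ω}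
    (h : ∃ j, ∀ i, ‖X j ω - ℓ‖ ≤ ‖X i ω - ℓ‖) (i : ℕ) :
    ‖servingStation X ℓ ω - ℓ‖ ≤ ‖X i ω - ℓ‖ :=
  Nat.sInf_mem (s := {j | ∀ i, ‖X j ω - ℓ‖ ≤ ‖X i ω - ℓ‖}) h i

variable {Ω : Type*} [MeasurableSpace Ω] {X : ℕ → Ω → Plane}

lemma measurable_servingIndex (hX : ∀ i, Measurable (X i)) (ℓ : Plane) :
    Measurable (servingIndex X ℓ) := by
  have hQ : ∀ j, MeasurableSet {ω | ∀ i, ‖X j ω - ℓ‖ ≤ ‖X i ω - ℓ‖} := by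
    intro j
    rw [Set.ofPred_forall]
    exact MeasurableSet.iInter fun i => measurableSet_le ((hX j).sub_const ℓ).norm
      ((hX i).sub_const ℓ).norm
  refine measurable_to_countable' fun n => ?_
  -- The last set of the union covers the default `sInf ∅ = 0`, used when no closest station exists.
  have heq : servingIndex X ℓ ⁻¹' {n} =
      ({ω | ∀ i, ‖X n ω - ℓ‖ ≤ ‖X i ω - ℓ‖} ∩
        ⋂ m, ⋂ (_ : m < n), {ω | ∀ i, ‖X m ω - ℓ‖ ≤ ‖X i ω - ℓ‖}ᶜ) ∪
      ({_ω | n = 0} ∩ ⋂ m, {ω | ∀ i, ‖X m ω - ℓ‖ ≤ ‖X i ω - ℓ‖}ᶜ) := by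
    ext ω
    set Q : Set ℕ := {j | ∀ i, ‖X j ω - ℓ‖ ≤ ‖X i ω - ℓ‖} with hQdef
    have hs : servingIndex X ℓ ω = sInf Q := rfl
    have hmem : ∀ m, ω ∈ {ω | ∀ i, ‖X m ω - ℓ‖ ≤ ‖X i ω - ℓ‖} ↔ m ∈ Q := fun m => Iff.rfl
    simp only [Set.mem_preimage, Set.mem_singleton_iff, Set.mem_union, Set.mem_inter_iff,
      Set.mem_iInter, Set.mem_compl_iff, hmem, hs, Set.mem_ofPred_eq]
    constructor
    · rintro rfl
      rcases Q.eq_empty_or_nonempty with hE | hN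
      · right
        simp [hE]
      · left
        exact ⟨Nat.sInf_mem hN, fun m hm => Nat.notMem_of_lt_sInf hm⟩
    · rintro (⟨h1, h2⟩ | ⟨h1, h2⟩)
      · refine le_antisymm (Nat.sInf_le h1) ?_
        by_contra hlt
        exact h2 _ (not_le.1 hlt) (Nat.sInf_mem ⟨n, h1⟩)
      · have hE : Q = ∅ := Set.eq_empty_of_forall_notMem h2
        simp [hE, h1]
  rw [heq]
  exact ((hQ n).inter (MeasurableSet.iInter fun m => MeasurableSet.iInter fun _ =>
    (hQ m).compl)).union ((MeasurableSet.const _).inter (MeasurableSet.iInter fun m =>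
    (hQ m).compl))

lemma measurable_servingStation (hX : ∀ i, Measurable (X i)) (ℓ : Plane) :
    Measurable (servingStation X ℓ) := by
  have h : Measurable fun p : Ω × ℕ => X p.2 p.1 :=
    measurable_from_prod_countable_left fun i => hX i
  exact h.comp (measurable_id.prodMk (measurable_servingIndex hX ℓ))

variable {P : Measure Ω} {lam : ℝ} {h : ℕ → Fin 2 → Ω → ℝ}

instance sigmaFinite_intensity (lam : ℝ) :
    SigmaFinite (ENNReal.ofReal lam • (volume : Measure Plane)) :=
  inferInstanceAs (SigmaFinite (lam.toNNReal • (volume : Measure Plane)))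

lemma intensity_closedBall (hlam : 0 < lam) (t : ℝ) :
    (ENNReal.ofReal lam • (volume : Measure Plane)) (Metric.closedBall 0 t) =
      ENNReal.ofReal (lam * Real.pi * max t 0 ^ 2) := by
  rw [Measure.smul_apply, volume_closedBall_plane, smul_eq_mul, ← ENNReal.ofReal_mul hlam.le,
    mul_assoc]

/-- Almost surely, the serving station is the unique closest one. -/
lemma ae_servingStation_lt (hlam : 0 < lam) (hnet : IsRayleighNetwork lam X h P) :
    ∀ᵐ ω ∂P, ∀ i, i ≠ servingIndex X 0 ω → ‖servingStation X 0 ω‖ < ‖X i ω‖ := by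
  -- Local finiteness yields existence of a closest station; the absence of ties in the norm,
  -- spheres being null sets, yields uniqueness.
  have hfin : ∀ᵐ ω ∂P, ∀ n : ℕ, pointCount X (Metric.closedBall 0 n) ω < ∞ := by
    rw [ae_all_iff]
    intro n
    have hΛ : (ENNReal.ofReal lam • (volume : Measure Plane)) (Metric.closedBall 0 n) ≠ ∞ := by
      rw [intensity_closedBall hlam]
      exact ENNReal.ofReal_ne_top
    refine ae_lt_top (measurable_pointCount hnet.measurable_position measurableSet_closedBall) ?_
    rwa [lintegral_pointCount hnet.injective_position hnet.poisson measurableSet_closedBall hΛ]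
  have hties := ae_injective_comp hnet.measurable_position hnet.injective_position hnet.poisson
    (f := fun x => ‖x‖) measurable_norm (fun c => by
      have : {x : Plane | ‖x‖ = c} = Metric.sphere 0 c := by ext; simp
      rw [Measure.smul_apply, this, Measure.addHaar_sphere, smul_zero])
  filter_upwards [hfin, hties] with ω hω hinj i hi
  -- This radius guarantees that the ball contains a station, so a minimum over the finitely many
  -- stations inside is a global minimum.
  obtain ⟨n, hn⟩ := exists_nat_ge ‖X 0 ω‖
  have hset : {i | X i ω ∈ Metric.closedBall 0 (n : ℝ)}.Finite := by
    refine (ENNReal.finite_const_le_of_tsum_ne_top (hω n).ne one_ne_zero).subset ?_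
    intro i hi
    have : X i ω ∈ Metric.closedBall 0 (n : ℝ) := hi
    simp only [Set.mem_ofPred_eq, Set.indicator_of_mem this, Pi.one_apply, le_refl]
  obtain ⟨j, hj, hmin⟩ := hset.exists_minimalFor (fun i => ‖X i ω‖) _
    ⟨0, by simpa using hn⟩
  have hex : ∃ j, ∀ i, ‖X j ω - 0‖ ≤ ‖X i ω - 0‖ := by
    refine ⟨j, fun i => ?_⟩
    simp only [sub_zero]
    by_contra hlt
    have hlt := not_le.1 hlt
    have hjn : ‖X j ω‖ ≤ n := by simpa using hj
    have himem : i ∈ {i | X i ω ∈ Metric.closedBall 0 (n : ℝ)} := by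
      simpa using hlt.le.trans hjn
    exact absurd (hmin himem hlt.le) (not_le.2 hlt)
  have hle := servingIndex_mem hex i
  simp only [sub_zero] at hle
  refine lt_of_le_of_ne hle fun heq => hi ?_
  exact (hinj (a₁ := servingIndex X 0 ω) (a₂ := i) heq).symm

/-- Turns events about the serving distance into void events of the Poisson process, whose
probabilities and independence are known. -/
lemma ae_lt_norm_servingStation_iff (hlam : 0 < lam) (hnet : IsRayleighNetwork lam X h P) (t : ℝ) :
    ∀ᵐ ω ∂P, t < ‖servingStation X 0 ω‖ ↔ pointCount X (Metric.closedBall 0 t) ω = 0 := by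
  filter_upwards [ae_servingStation_lt hlam hnet] with ω hω
  rw [pointCount_eq_zero_iff]
  constructor
  · intro ht i hi
    have hi' : ‖X i ω‖ ≤ t := by simpa using hi
    by_cases his : i = servingIndex X 0 ω
    · subst his
      exact absurd ht (not_lt.2 hi')
    · exact absurd (ht.trans (hω i his)) (not_lt.2 hi')
  · intro hall
    have := hall (servingIndex X 0 ω)
    simpa [servingStation] using this

lemma measure_lt_norm_servingStation (hlam : 0 < lam) (hnet : IsRayleighNetwork lam X h P)
    (t : ℝ) : P {ω | t < ‖servingStation X 0 ω‖} =
      ENNReal.ofReal (Real.exp (-(lam * Real.pi * max t 0 ^ 2))) := by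
  have hΛ := intensity_closedBall hlam t
  have := measure_pointCount_eq_zero hnet.measurable_position hnet.injective_position hnet.poisson
    (B := Metric.closedBall 0 t) measurableSet_closedBall (hΛ ▸ ENNReal.ofReal_ne_top)
  rw [hΛ, ENNReal.toReal_ofReal (by positivity)] at this
  rw [← this]
  refine measure_congr ?_
  filter_upwards [ae_lt_norm_servingStation_iff hlam hnet t] with ω hω
  exact propext hω

/-- The law of the serving distance. -/
lemma hasLaw_norm_servingStation [IsProbabilityMeasure P] (hlam : 0 < lam)
    (hnet : IsRayleighNetwork lam X h P) :
    HasLaw (fun ω => ‖servingStation X 0 ω‖)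
      (volume.withDensity fun r => ENNReal.ofReal (servingDistanceDensity lam r)) P := by
  have hm : Measurable fun ω => ‖servingStation X 0 ω‖ :=
    (measurable_servingStation hnet.measurable_position 0).norm
  refine ⟨hm.aemeasurable, ?_⟩
  have : IsProbabilityMeasure (P.map fun ω => ‖servingStation X 0 ω‖) :=
    Measure.isProbabilityMeasure_map hm.aemeasurable
  have htail : ∀ t, P.map (fun ω => ‖servingStation X 0 ω‖) (Set.Ioi t) =
      ENNReal.ofReal (Real.exp (-(lam * Real.pi * max t 0 ^ 2))) := by
    intro t
    rw [Measure.map_apply hm measurableSet_Ioi, ← measure_lt_norm_servingStation hlam hnet]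
    rfl
  refine Measure.ext_of_Ioc' _ _ (fun a b _ => measure_ne_top _ _) fun a b hab => ?_
  unfold servingDistanceDensity
  rw [withDensity_half_line_Ioc (G := fun r => -Real.exp (-(lam * Real.pi * r ^ 2)))
    (by fun_prop) (fun r => ?_) (fun r hr => by positivity) hab.le, ← Set.Ioi_sdiff_Ioi,
    measure_sdiff (Set.Ioi_subset_Ioi hab.le) measurableSet_Ioi.nullMeasurableSet
    (measure_ne_top _ _), htail, htail, ← ENNReal.ofReal_sub _ (Real.exp_nonneg _)]
  · congr 1
    ring
  · have h1 := (((((hasDerivAt_id r).pow 2).const_mul (lam * Real.pi)).neg).exp).neg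
    simp only [id_eq] at h1
    convert! h1 using 1
    norm_num
    ring_nf

/-- Expectations of functions of the serving distance as integrals over the plane. -/
lemma lintegral_norm_servingStation [IsProbabilityMeasure P] (hlam : 0 < lam)
    (hnet : IsRayleighNetwork lam X h P) {f : ℝ → ℝ≥0∞} (hf : Measurable f) :
    ∫⁻ ω, f ‖servingStation X 0 ω‖ ∂P =
      ∫⁻ x : Plane, f ‖x‖ * P {ω | ‖x‖ < ‖servingStation X 0 ω‖}
        ∂(ENNReal.ofReal lam • (volume : Measure Plane)) := by
  have hm : Measurable fun ω => ‖servingStation X 0 ω‖ :=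
    (measurable_servingStation hnet.measurable_position 0).norm
  set q : ℝ → ℝ≥0∞ := fun t => ENNReal.ofReal (Real.exp (-(lam * Real.pi * max t 0 ^ 2))) with hq
  have hqm : Measurable q := by fun_prop
  have hfq : Measurable fun r => f r * q r := hf.mul hqm
  have hdens : Measurable fun r : ℝ => ENNReal.ofReal (if 0 ≤ r then 2 * Real.pi * r else 0) :=
    (Measurable.ite measurableSet_Ici (by fun_prop) measurable_const).ennreal_ofReal
  have hdens2 : Measurable fun r : ℝ => ENNReal.ofReal (servingDistanceDensity lam r) :=
    (Measurable.ite measurableSet_Ici (by fun_prop) measurable_const).ennreal_ofReal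
  simp_rw [measure_lt_norm_servingStation hlam hnet]
  rw [← lintegral_map hf hm, (hasLaw_norm_servingStation hlam hnet).map_eq,
    lintegral_smul_measure,
    ← lintegral_map (f := fun r => f r * q r) (g := fun x : Plane => ‖x‖) hfq
      measurable_norm, map_norm_volume_plane,
    lintegral_withDensity_eq_lintegral_mul _ hdens hfq,
    lintegral_withDensity_eq_lintegral_mul _ hdens2 hf, smul_eq_mul,
    ← lintegral_const_mul _ (hdens.mul hfq)]
  -- The density of the serving distance factors as `lam`, the circumference `2πr`, and the
  -- probability that the ball of radius `r` is empty.
  refine lintegral_congr fun r => ?_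
  simp only [Pi.mul_apply, servingDistanceDensity, hq]
  by_cases hr : 0 ≤ r
  · simp only [hr, if_true, max_eq_left]
    have : 2 * lam * Real.pi * r * Real.exp (-lam * Real.pi * r ^ 2) =
        lam * (2 * Real.pi * r) * Real.exp (-(lam * Real.pi * r ^ 2)) := by
      rw [neg_mul, neg_mul]
      ring
    rw [this, ENNReal.ofReal_mul (by positivity), ENNReal.ofReal_mul hlam.le]
    ring
  · simp [hr]

/-- The joint mean of a function of the serving distance and of a radial sum over all stations:
the serving station contributes its own term, and beyond it the process has its original
intensity. -/
lemma lintegral_servingStation_mul_pointSum [IsProbabilityMeasure P] (hlam : 0 < lam)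
    (hnet : IsRayleighNetwork lam X h P) {f : ℝ → ℝ≥0∞} (hf : Measurable f)
    (hfin : ∫⁻ x : Plane, f ‖x‖ ∂(ENNReal.ofReal lam • (volume : Measure Plane)) ≠ ∞)
    {φ : ℝ → ℝ≥0∞} (hφ : Measurable φ) :
    ∫⁻ ω, φ ‖servingStation X 0 ω‖ * pointSum X (fun x => f ‖x‖) ω ∂P =
      ∫⁻ ω, φ ‖servingStation X 0 ω‖ * (f ‖servingStation X 0 ω‖ +
        ∫⁻ x in (Metric.ball (0 : Plane) ‖servingStation X 0 ω‖)ᶜ, f ‖x‖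
          ∂(ENNReal.ofReal lam • (volume : Measure Plane))) ∂P := by
  set Λ : Measure Plane := ENNReal.ofReal lam • (volume : Measure Plane) with hΛdef
  have hX := hnet.measurable_position
  set R : Ω → ℝ := fun ω => ‖servingStation X 0 ω‖ with hR
  have Rdef : ∀ ω, ‖servingStation X 0 ω‖ = R ω := fun ω => rfl
  have hm : Measurable R := (measurable_servingStation hX 0).norm
  have hF : Measurable fun x : Plane => f ‖x‖ := hf.comp measurable_norm
  have hG := measurable_pointSum hX hF
  set T : ℝ → ℝ≥0∞ := fun r => ∫⁻ x in (Metric.ball (0 : Plane) r)ᶜ, f ‖x‖ ∂Λ with hT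
  set K : ℝ → Plane → ℝ≥0∞ := fun r x => if r ≤ ‖x‖ then f ‖x‖ else 0 with hK
  have hKm : Measurable (Function.uncurry K) :=
    Measurable.ite (measurableSet_le measurable_fst measurable_snd.norm)
      (hF.comp measurable_snd) measurable_const
  have hTK : ∀ r, T r = ∫⁻ x, K r x ∂Λ := by
    intro r
    simp only [hT]
    rw [← lintegral_indicator measurableSet_ball.compl]
    refine lintegral_congr fun x => ?_
    by_cases hx : r ≤ ‖x‖ <;> simp [hK, hx]
  have hTm : Measurable T := by
    have : T = fun r => ∫⁻ x, K r x ∂Λ := funext hTK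
    rw [this]
    exact hKm.lintegral_prod_right'
  have hprob : IsProbabilityMeasure (P.map R) := Measure.isProbabilityMeasure_map hm.aemeasurable
  have htail : ∀ t, P.map R (Set.Ioi t) = P {ω | t < R ω} := fun t =>
    Measure.map_apply hm measurableSet_Ioi
  have hfinG : ∫⁻ ω, pointSum X (fun x => f ‖x‖) ω ∂P ≠ ∞ := by
    rwa [lintegral_pointSum hX hnet.injective_position hnet.poisson hF]
  have : IsFiniteMeasure (P.withDensity (pointSum X fun x => f ‖x‖)) :=
    isFiniteMeasure_withDensity hfinG
  -- It suffices to compare the tails `R > t`. On the left, emptiness of the closed ball is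
  -- independent of the points outside. On the right, a point `x` with `‖x‖ > t` gets weight `P(R >
  -- ‖x‖)` as serving station and `P(t < R ≤ ‖x‖)` as interferer; these add up to `P(R > t)`.
  have hmeas : (P.withDensity (pointSum X fun x => f ‖x‖)).map R =
      (P.map R).withDensity (fun r => f r + T r) := by
    refine measure_ext_of_Ioi fun t => ?_
    have hset : MeasurableSet {ω | t < R ω} := hm measurableSet_Ioi
    have hlhs : (P.withDensity (pointSum X fun x => f ‖x‖)).map R (Set.Ioi t) =
        P {ω | t < R ω} * ∫⁻ x in (Metric.closedBall (0 : Plane) t)ᶜ, f ‖x‖ ∂Λ := by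
      have hae : {ω | t < R ω} =ᵐ[P] {ω | pointCount X (Metric.closedBall 0 t) ω = 0} := by
        filter_upwards [ae_lt_norm_servingStation_iff hlam hnet t] with ω hω
        exact propext hω
      have hset' : R ⁻¹' Set.Ioi t = {ω | t < R ω} := rfl
      rw [Measure.map_apply hm measurableSet_Ioi, hset', withDensity_apply _ hset,
        setLIntegral_congr hae, measure_congr hae]
      exact setLIntegral_pointSum_of_pointCount_eq_zero hX hnet.injective_position hnet.poisson
        measurableSet_closedBall (by
          rw [intensity_closedBall hlam]
          exact ENNReal.ofReal_ne_top) hF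
    have hA : ∫⁻ r in Set.Ioi t, f r ∂(P.map R) =
        ∫⁻ x in (Metric.closedBall (0 : Plane) t)ᶜ, f ‖x‖ * P.map R (Set.Ioi ‖x‖) ∂Λ := by
      rw [← lintegral_indicator measurableSet_Ioi,
        lintegral_map (hf.indicator measurableSet_Ioi) hm,
        lintegral_norm_servingStation hlam hnet (hf.indicator measurableSet_Ioi),
        ← lintegral_indicator measurableSet_closedBall.compl]
      refine lintegral_congr fun x => ?_
      by_cases hx : t < ‖x‖ <;> simp [hx, htail, Rdef]
    -- After Tonelli, `r` ranges over `Ioc t ‖x‖`. This is empty for `‖x‖ ≤ t`, so restricting `x`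
    -- to the complement of the closed ball loses nothing.
    have hB : ∫⁻ r in Set.Ioi t, T r ∂(P.map R) =
        ∫⁻ x in (Metric.closedBall (0 : Plane) t)ᶜ, f ‖x‖ * P.map R (Set.Ioc t ‖x‖) ∂Λ := by
      simp_rw [hTK]
      rw [lintegral_lintegral_swap hKm.aemeasurable,
        ← lintegral_indicator measurableSet_closedBall.compl]
      refine lintegral_congr fun x => ?_
      rw [← lintegral_indicator measurableSet_Ioi]
      have : ∀ r, (Set.Ioi t).indicator (fun r => K r x) r =
          (Set.Ioc t ‖x‖).indicator (fun _ => f ‖x‖) r := by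
        intro r
        by_cases h1 : t < r <;> by_cases h2 : r ≤ ‖x‖ <;> simp [hK, h1, h2]
      simp_rw [this]
      rw [lintegral_indicator_const measurableSet_Ioc]
      by_cases hx : t < ‖x‖
      · simp [hx]
      · simp [hx]
    have hsum : ∀ x ∈ (Metric.closedBall (0 : Plane) t)ᶜ,
        f ‖x‖ * P.map R (Set.Ioi ‖x‖) + f ‖x‖ * P.map R (Set.Ioc t ‖x‖) =
          P {ω | t < R ω} * f ‖x‖ := by
      intro x hx
      have hx' : t ≤ ‖x‖ := by
        have : t < ‖x‖ := by simpa using hx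
        exact this.le
      rw [← mul_add, ← htail t, ← Set.Ioc_union_Ioi_eq_Ioi hx', measure_union
        (Set.Ioc_disjoint_Ioi le_rfl) measurableSet_Ioi, mul_comm, add_comm]
    have hmono : Measurable fun x : Plane => P.map R (Set.Ioi ‖x‖) := by
      simp_rw [htail, hR, measure_lt_norm_servingStation hlam hnet]
      fun_prop
    have hmA : Measurable fun x : Plane => f ‖x‖ * P.map R (Set.Ioi ‖x‖) := hF.mul hmono
    rw [hlhs, withDensity_apply _ measurableSet_Ioi, lintegral_add_left hf, hA, hB,
      ← lintegral_add_left hmA, setLIntegral_congr_fun measurableSet_closedBall.compl hsum,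
      lintegral_const_mul _ hF]
  have hφR : Measurable fun ω => φ (R ω) := hφ.comp hm
  have hfT : Measurable fun r => f r + T r := hf.add hTm
  have h1 : ∫⁻ ω, φ (R ω) * pointSum X (fun x => f ‖x‖) ω ∂P =
      ∫⁻ r, φ r ∂((P.withDensity (pointSum X fun x => f ‖x‖)).map R) := by
    rw [lintegral_map hφ hm, lintegral_withDensity_eq_lintegral_mul _ hG hφR]
    simp [mul_comm]
  rw [h1, hmeas, lintegral_withDensity_eq_lintegral_mul _ hfT hφ,
    lintegral_map (hfT.mul hφ) hm]
  exact lintegral_congr fun ω => mul_comm _ _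

end Serving

/-! ### Moments of the fading gains -/

section Fading

lemma fadingLaw_eq_withDensity : fadingLaw = volume.withDensity (exponentialPDF 1) := rfl

lemma measurable_exponentialPDF_one : Measurable (exponentialPDF 1) :=
  (measurable_exponentialPDFReal 1).ennreal_ofReal

/-- The moments of the exponential law are values of the Gamma integral at `n + 1`. -/
lemma lintegral_pow_fadingLaw (n : ℕ) :
    ∫⁻ y, ENNReal.ofReal y ^ n ∂fadingLaw = n.factorial := by
  rw [fadingLaw_eq_withDensity, lintegral_withDensity_eq_lintegral_mul _
    measurable_exponentialPDF_one (by fun_prop)]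
  have hint := Real.GammaIntegral_convergent (s := n + 1) (by positivity)
  have h1 : ∫⁻ y, (exponentialPDF 1 * fun y => ENNReal.ofReal y ^ n) y =
      ∫⁻ y in Set.Ioi (0 : ℝ), ENNReal.ofReal (Real.exp (-y) * y ^ ((n : ℝ) + 1 - 1)) := by
    rw [← lintegral_indicator measurableSet_Ioi]
    refine lintegral_congr_ae ?_
    filter_upwards [compl_mem_ae_iff.2 (measure_singleton (μ := volume) (0 : ℝ))] with y hy
    have hy0 : y ≠ 0 := hy
    rcases lt_or_gt_of_ne hy0 with hlt | hgt
    · rw [Set.indicator_of_notMem (by simpa using hlt.le), Pi.mul_apply,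
        exponentialPDF_of_neg hlt, zero_mul]
    · rw [Set.indicator_of_mem (by simpa using hgt), Pi.mul_apply,
        exponentialPDF_of_nonneg hgt.le, ← ENNReal.ofReal_pow hgt.le,
        ← ENNReal.ofReal_mul (by positivity), add_sub_cancel_right, Real.rpow_natCast]
      simp
  rw [h1, ← ofReal_integral_eq_lintegral_ofReal hint, ← Real.Gamma_eq_integral (by positivity),
    Real.Gamma_nat_eq_factorial, ENNReal.ofReal_natCast]
  filter_upwards [ae_restrict_mem measurableSet_Ioi] with y hy
  have : 0 < y := hy
  positivity

lemma ae_nonneg_fadingLaw : ∀ᵐ y ∂fadingLaw, 0 ≤ y := by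
  rw [fadingLaw_eq_withDensity, ae_withDensity_iff measurable_exponentialPDF_one]
  refine Filter.Eventually.of_forall fun y hy => ?_
  by_contra hneg
  exact hy (exponentialPDF_of_neg (not_le.1 hneg))

lemma integral_sq_fadingLaw : ∫ y, y ^ 2 ∂fadingLaw = 2 := by
  rw [integral_eq_lintegral_of_nonneg_ae (Filter.Eventually.of_forall fun y => sq_nonneg y)
    (by fun_prop)]
  have : ∫⁻ y, ENNReal.ofReal (y ^ 2) ∂fadingLaw = ∫⁻ y, ENNReal.ofReal y ^ 2 ∂fadingLaw := by
    refine lintegral_congr_ae ?_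
    filter_upwards [ae_nonneg_fadingLaw] with y hy
    rw [ENNReal.ofReal_pow hy]
  rw [this, lintegral_pow_fadingLaw]
  simp

variable {Ω : Type*} [MeasurableSpace Ω] {P : Measure Ω} {lam : ℝ} {X : ℕ → Ω → Plane}
  {h : ℕ → Fin 2 → Ω → ℝ}

lemma ae_gain_nonneg (hnet : IsRayleighNetwork lam X h P) :
    ∀ᵐ ω ∂P, ∀ i k, 0 ≤ h i k ω := by
  rw [ae_all_iff]
  intro i
  rw [ae_all_iff]
  intro k
  refine (hnet.gain_law i k).ae_iff (p := fun y => 0 ≤ y) ?_ |>.2 ae_nonneg_fadingLaw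
  exact measurableSet_setOfPred.1 measurableSet_Ici

lemma lintegral_gain_pow (hnet : IsRayleighNetwork lam X h P) (i : ℕ) (k : Fin 2) (n : ℕ) :
    ∫⁻ ω, ENNReal.ofReal (h i k ω) ^ n ∂P = n.factorial := by
  rw [← lintegral_pow_fadingLaw n, ← (hnet.gain_law i k).map_eq,
    lintegral_map (by fun_prop) (hnet.measurable_gain i k)]

lemma lintegral_gain (hnet : IsRayleighNetwork lam X h P) (i : ℕ) (k : Fin 2) :
    ∫⁻ ω, ENNReal.ofReal (h i k ω) ∂P = 1 := by
  simpa using lintegral_gain_pow hnet i k 1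

lemma measurable_ofReal_gain (hnet : IsRayleighNetwork lam X h P) (i : ℕ) (k : Fin 2) :
    Measurable fun ω => ENNReal.ofReal (h i k ω) :=
  (hnet.measurable_gain i k).ennreal_ofReal

/-- The product of the unit means, plus the covariance: independence kills it except for a gain with
itself, where it is the variance `2 - 1`. -/
lemma lintegral_gain_mul_gain (hnet : IsRayleighNetwork lam X h P) (i j : ℕ) (k l : Fin 2) :
    ∫⁻ ω, ENNReal.ofReal (h i k ω) * ENNReal.ofReal (h j l ω) ∂P =
      1 + if i = j ∧ k = l then 1 else 0 := by
  by_cases hij : i = j ∧ k = l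
  · obtain ⟨rfl, rfl⟩ := hij
    simp_rw [← pow_two]
    rw [lintegral_gain_pow hnet]
    norm_num
  · have hne : (i, k) ≠ (j, l) := by simpa using hij
    have hind := (hnet.gain_indep.indepFun hne).comp ENNReal.measurable_ofReal
      ENNReal.measurable_ofReal
    have := lintegral_mul_eq_lintegral_mul_lintegral_of_indepFun (measurable_ofReal_gain hnet i k)
      (measurable_ofReal_gain hnet j l) hind
    simp only [Pi.mul_apply, lintegral_gain hnet] at this
    simp [this, hij]

/-- Gains and positions are independent. -/
lemma lintegral_gain_mul_position (hnet : IsRayleighNetwork lam X h P)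
    {u : (ℕ × Fin 2 → ℝ) → ℝ≥0∞} (hu : Measurable u) {v : (ℕ → Plane) → ℝ≥0∞}
    (hv : Measurable v) :
    ∫⁻ ω, u (fun p => h p.1 p.2 ω) * v (fun i => X i ω) ∂P =
      (∫⁻ ω, u (fun p => h p.1 p.2 ω) ∂P) * ∫⁻ ω, v (fun i => X i ω) ∂P := by
  have h1 : Measurable fun ω (p : ℕ × Fin 2) => h p.1 p.2 ω :=
    measurable_pi_lambda _ fun p => hnet.measurable_gain p.1 p.2
  have h2 : Measurable fun ω i => X i ω := measurable_pi_lambda _ hnet.measurable_position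
  exact lintegral_mul_eq_lintegral_mul_lintegral_of_indepFun (hu.comp h1) (hv.comp h2)
    (hnet.gain_indep_position.comp hu hv)

/-- The sum of the terms `w i`, which depend on the positions, weighted by the gains in the
slot `k`. -/
noncomputable def gainSum (X : ℕ → Ω → Plane) (h : ℕ → Fin 2 → Ω → ℝ)
    (w : ℕ → (ℕ → Plane) → ℝ≥0∞) (k : Fin 2) (ω : Ω) : ℝ≥0∞ :=
  ∑' i, ENNReal.ofReal (h i k ω) * w i (fun n => X n ω)

lemma measurable_comp_position (hnet : IsRayleighNetwork lam X h P) {v : (ℕ → Plane) → ℝ≥0∞}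
    (hv : Measurable v) : Measurable fun ω => v (fun n => X n ω) :=
  hv.comp (measurable_pi_lambda _ hnet.measurable_position)

lemma measurable_gainSum (hnet : IsRayleighNetwork lam X h P) {w : ℕ → (ℕ → Plane) → ℝ≥0∞}
    (hw : ∀ i, Measurable (w i)) (k : Fin 2) : Measurable (gainSum X h w k) :=
  Measurable.tsum fun i => (measurable_ofReal_gain hnet i k).mul
    (measurable_comp_position hnet (hw i))

lemma lintegral_gainSum (hnet : IsRayleighNetwork lam X h P) {w : ℕ → (ℕ → Plane) → ℝ≥0∞}
    (hw : ∀ i, Measurable (w i)) (k : Fin 2) :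
    ∫⁻ ω, gainSum X h w k ω ∂P = ∫⁻ ω, ∑' i, w i (fun n => X n ω) ∂P := by
  unfold gainSum
  have hm : ∀ i, Measurable fun ω => ENNReal.ofReal (h i k ω) * w i (fun n => X n ω) := fun i =>
    (measurable_ofReal_gain hnet i k).mul (measurable_comp_position hnet (hw i))
  rw [lintegral_tsum fun i => (hm i).aemeasurable,
    lintegral_tsum fun i => (measurable_comp_position hnet (hw i)).aemeasurable]
  refine tsum_congr fun i => ?_
  have := lintegral_gain_mul_position hnet
    (u := fun y => ENNReal.ofReal (y (i, k))) (measurable_pi_apply _).ennreal_ofReal (hw i)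
  simpa [lintegral_gain hnet] using this

/-- Expand the double sum and integrate out the gains. Every pair contributes as if the gains were
1; within one slot, the unit variance adds the diagonal once more. This extra term is the only
difference between the same slot and different slots. -/
lemma lintegral_gainSum_mul_gainSum (hnet : IsRayleighNetwork lam X h P)
    {w : ℕ → (ℕ → Plane) → ℝ≥0∞} (hw : ∀ i, Measurable (w i)) (k l : Fin 2) :
    ∫⁻ ω, gainSum X h w k ω * gainSum X h w l ω ∂P =
      (∫⁻ ω, (∑' i, w i (fun n => X n ω)) * (∑' i, w i (fun n => X n ω)) ∂P) +
        if k = l then ∫⁻ ω, ∑' i, w i (fun n => X n ω) * w i (fun n => X n ω) ∂P else 0 := by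
  have hpos := fun i => measurable_comp_position hnet (hw i)
  have hm : ∀ i k, Measurable fun ω => ENNReal.ofReal (h i k ω) * w i (fun n => X n ω) :=
    fun i k => (measurable_ofReal_gain hnet i k).mul (hpos i)
  have hmm : ∀ i j, Measurable fun ω => ENNReal.ofReal (h i k ω) * w i (fun n => X n ω) *
      (ENNReal.ofReal (h j l ω) * w j (fun n => X n ω)) := fun i j => (hm i k).mul (hm j l)
  have hww : ∀ i j, Measurable fun ω => w i (fun n => X n ω) * w j (fun n => X n ω) :=
    fun i j => (hpos i).mul (hpos j)
  have hterm : ∀ i j, ∫⁻ ω, ENNReal.ofReal (h i k ω) * w i (fun n => X n ω) *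
      (ENNReal.ofReal (h j l ω) * w j (fun n => X n ω)) ∂P =
      (∫⁻ ω, w i (fun n => X n ω) * w j (fun n => X n ω) ∂P) +
        if j = i then (if k = l then ∫⁻ ω, w i (fun n => X n ω) * w i (fun n => X n ω) ∂P else 0)
        else 0 := by
    intro i j
    have h1 := lintegral_gain_mul_position hnet
      (u := fun y => ENNReal.ofReal (y (i, k)) * ENNReal.ofReal (y (j, l)))
      ((measurable_pi_apply _).ennreal_ofReal.mul (measurable_pi_apply _).ennreal_ofReal)
      (v := fun x => w i x * w j x) ((hw i).mul (hw j))
    simp only [lintegral_gain_mul_gain hnet] at h1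
    simp_rw [mul_mul_mul_comm]
    rw [h1, add_mul, one_mul]
    congr 1
    by_cases hij : j = i
    · subst hij
      by_cases hkl : k = l <;> simp [hkl]
    · simp [hij, Ne.symm hij]
  unfold gainSum
  simp_rw [← ENNReal.tsum_mul_right, ← ENNReal.tsum_mul_left]
  rw [lintegral_tsum fun i => (Measurable.tsum (hmm i)).aemeasurable,
    lintegral_tsum fun i => (Measurable.tsum (hww i)).aemeasurable]
  have hdiag : (if k = l then ∫⁻ ω, ∑' i, w i (fun n => X n ω) * w i (fun n => X n ω) ∂P else 0) =
      ∑' i, if k = l then ∫⁻ ω, w i (fun n => X n ω) * w i (fun n => X n ω) ∂P else 0 := by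
    by_cases hkl : k = l
    · simp only [hkl, if_true]
      rw [lintegral_tsum fun i => (hww i i).aemeasurable]
    · simp [hkl]
  rw [hdiag, ← ENNReal.tsum_add]
  refine tsum_congr fun i => ?_
  rw [lintegral_tsum fun j => (hmm i j).aemeasurable,
    lintegral_tsum fun j => (hww i j).aemeasurable]
  simp_rw [hterm]
  rw [ENNReal.tsum_add, tsum_ite_eq]

end Fading

/-! ### The path-loss function -/

section PathLoss

lemma pathLoss_pos {ε α : ℝ} (hε : 0 < ε) (x : Plane) : 0 < pathLoss ε α x := by
  unfold pathLoss
  positivity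

lemma pathLoss_le {ε α : ℝ} (hε : 0 < ε) (x : Plane) : pathLoss ε α x ≤ 1 / ε := by
  unfold pathLoss
  exact one_div_le_one_div_of_le hε (by linarith [Real.rpow_nonneg (norm_nonneg x) α])

lemma measurable_pathLoss (ε α : ℝ) : Measurable (pathLoss ε α) := by
  unfold pathLoss
  fun_prop

lemma integrable_pathLoss {ε α : ℝ} (hε : 0 < ε) (hα : 2 < α) : Integrable (pathLoss ε α) := by
  have h1 : Integrable fun x : Plane => (1 + ‖x‖) ^ (-α) :=
    integrable_one_add_norm (by simpa using hα)
  -- The factor `2 ^ α` comes from `(1 + s) ^ α ≤ 2 ^ α * (1 + s ^ α)`, the factor `max 1 (1 / ε)`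
  -- from replacing `1 + s ^ α` by `ε + s ^ α`.
  refine (h1.const_mul (2 ^ α * max 1 (1 / ε))).mono' (measurable_pathLoss ε α).aestronglyMeasurable
    (Filter.Eventually.of_forall fun x => ?_)
  rw [Real.norm_of_nonneg (pathLoss_pos hε x).le, pathLoss, Real.rpow_neg (by positivity),
    ← div_eq_mul_inv, div_le_div_iff₀ (by positivity) (by positivity), one_mul]
  have hx := norm_nonneg x
  have hα0 : 0 ≤ α := by linarith
  have hxα := Real.rpow_nonneg hx α
  have hmax : (1 + ‖x‖) ^ α ≤ 2 ^ α * (1 + ‖x‖ ^ α) := by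
    have h2 : 1 + ‖x‖ ≤ 2 * max 1 ‖x‖ := by
      have := le_max_left 1 ‖x‖
      have := le_max_right 1 ‖x‖
      linarith
    calc (1 + ‖x‖) ^ α ≤ (2 * max 1 ‖x‖) ^ α := Real.rpow_le_rpow (by positivity) h2 hα0
      _ = 2 ^ α * max 1 ‖x‖ ^ α := Real.mul_rpow (by norm_num) (by positivity)
      _ ≤ 2 ^ α * (1 + ‖x‖ ^ α) := by
        gcongr
        rcases max_cases 1 ‖x‖ with ⟨h, _⟩ | ⟨h, _⟩
        · rw [h, Real.one_rpow]; linarith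
        · rw [h]; linarith
  have hε' : 1 ≤ max 1 (1 / ε) * ε := by
    calc (1 : ℝ) = 1 / ε * ε := by field_simp
      _ ≤ _ := by gcongr; exact le_max_right _ _
  have hM : 1 + ‖x‖ ^ α ≤ max 1 (1 / ε) * (ε + ‖x‖ ^ α) := by
    have : ‖x‖ ^ α ≤ max 1 (1 / ε) * ‖x‖ ^ α := le_mul_of_one_le_left hxα (le_max_left _ _)
    linarith
  calc (1 + ‖x‖) ^ α ≤ 2 ^ α * (1 + ‖x‖ ^ α) := hmax
    _ ≤ 2 ^ α * (max 1 (1 / ε) * (ε + ‖x‖ ^ α)) := by gcongr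
    _ = _ := by ring

lemma integrable_pathLoss_sq {ε α : ℝ} (hε : 0 < ε) (hα : 2 < α) :
    Integrable fun x => pathLoss ε α x ^ 2 := by
  refine ((integrable_pathLoss hε hα).const_mul (1 / ε)).mono'
    ((measurable_pathLoss ε α).pow_const 2).aestronglyMeasurable
    (Filter.Eventually.of_forall fun x => ?_)
  rw [Real.norm_of_nonneg (sq_nonneg _), pow_two]
  exact mul_le_mul_of_nonneg_right (pathLoss_le hε x) (pathLoss_pos hε x).le

end PathLoss

/-! ### Moments of the interference -/

section Interference

lemma ae_lt_top_of_lintegral_mul_self {Ω : Type*} [MeasurableSpace Ω] {P : Measure Ω}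
    {v : Ω → ℝ≥0∞} (hv : Measurable v) (hfin : ∫⁻ ω, v ω * v ω ∂P ≠ ∞) :
    ∀ᵐ ω ∂P, v ω < ∞ := by
  have hm : Measurable fun ω => v ω * v ω := hv.mul hv
  filter_upwards [ae_lt_top hm hfin] with ω hω
  by_contra htop
  simp [not_lt_top_iff.1 htop] at hω

lemma memLp_two_toReal {Ω : Type*} [MeasurableSpace Ω] {P : Measure Ω} {v : Ω → ℝ≥0∞}
    (hv : Measurable v) (hfin : ∫⁻ ω, v ω * v ω ∂P ≠ ∞) :
    MemLp (fun ω => (v ω).toReal) 2 P := by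
  rw [memLp_two_iff_integrable_sq hv.ennreal_toReal.aestronglyMeasurable]
  have := integrable_toReal_of_lintegral_ne_top (hv.mul hv).aemeasurable hfin
  simpa [pow_two, ENNReal.toReal_mul] using this

/-- The path loss of the station `i` at the origin if this station interferes, as a function of all
positions. -/
noncomputable def interferenceWeight (ε α : ℝ) (i : ℕ) (x : ℕ → Plane) : ℝ≥0∞ :=
  if i = servingIndex (fun n (y : ℕ → Plane) => y n) 0 x then 0
  else ENNReal.ofReal (pathLoss ε α (x i))

lemma measurable_interferenceWeight (ε α : ℝ) (i : ℕ) : Measurable (interferenceWeight ε α i) := by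
  refine Measurable.ite ?_ measurable_const
    (((measurable_pathLoss ε α).comp (measurable_pi_apply i)).ennreal_ofReal)
  exact measurableSet_eq_fun measurable_const
    (measurable_servingIndex (fun n => measurable_pi_apply n) 0)

variable {Ω : Type*} {X : ℕ → Ω → Plane} {h : ℕ → Fin 2 → Ω → ℝ}

/-- The serving index depends on `ω` only through the positions. This makes the weights functions of
the position sequence, to which independence from the gains applies. -/
lemma interferenceWeight_position (ε α : ℝ) (i : ℕ) (ω : Ω) :
    interferenceWeight ε α i (fun n => X n ω) =
      if i = servingIndex X 0 ω then 0 else ENNReal.ofReal (pathLoss ε α (X i ω)) := rfl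

/-- Every sum over the stations splits into the serving and the interfering stations. -/
lemma pointSum_eq_tsum_add_servingStation (f : Plane → ℝ≥0∞) (ω : Ω) :
    pointSum X f ω = (∑' i, if i = servingIndex X 0 ω then 0 else f (X i ω)) +
      f (servingStation X 0 ω) := by
  rw [← tsum_ite_eq (servingIndex X 0 ω) (fun _ => f (servingStation X 0 ω)), ← ENNReal.tsum_add]
  refine tsum_congr fun i => ?_
  by_cases hi : i = servingIndex X 0 ω
  · subst hi
    simp [servingStation]
  · simp [hi]

lemma interferencePower_eq_toReal {ε α : ℝ} (hε : 0 < ε) {ω : Ω} (hω : ∀ i k, 0 ≤ h i k ω)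
    (k : Fin 2) (i : ℕ) : interferencePower ε α X h k 0 ω i =
      (ENNReal.ofReal (h i k ω) * interferenceWeight ε α i (fun n => X n ω)).toReal := by
  rw [interferenceWeight_position, interferencePower, sub_zero]
  split_ifs
  · simp
  · rw [ENNReal.toReal_mul, ENNReal.toReal_ofReal (hω i k),
      ENNReal.toReal_ofReal (pathLoss_pos hε _).le]

/-- Only finiteness of each term is needed: if the series diverges, both sides take the default
value `0`. -/
lemma interference_eq_toReal_gainSum {ε α : ℝ} (hε : 0 < ε) {ω : Ω} (hω : ∀ i k, 0 ≤ h i k ω)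
    (k : Fin 2) :
    interference ε α X h k 0 ω = (gainSum X h (interferenceWeight ε α) k ω).toReal := by
  rw [interference, gainSum, ENNReal.tsum_toReal_eq]
  · exact tsum_congr fun i => interferencePower_eq_toReal hε hω k i
  · intro i
    refine ENNReal.mul_ne_top ENNReal.ofReal_ne_top ?_
    unfold interferenceWeight
    split_ifs
    · exact ENNReal.zero_ne_top
    · exact ENNReal.ofReal_ne_top

lemma summable_interferencePower {ε α : ℝ} (hε : 0 < ε) {ω : Ω} (hω : ∀ i k, 0 ≤ h i k ω)
    {k : Fin 2} (hfin : gainSum X h (interferenceWeight ε α) k ω < ∞) :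
    Summable (interferencePower ε α X h k 0 ω) :=
  (ENNReal.summable_toReal hfin.ne).congr fun i => (interferencePower_eq_toReal hε hω k i).symm

end Interference

/-- The integral of a function over balls depends measurably on the radius. -/
lemma measurable_lintegral_ball {Λ : Measure Plane} [SFinite Λ] {f : Plane → ℝ≥0∞}
    (hf : Measurable f) : Measurable fun r => ∫⁻ x in Metric.ball (0 : Plane) r, f x ∂Λ := by
  have hK : Measurable (Function.uncurry fun (r : ℝ) (x : Plane) => if ‖x‖ < r then f x else 0) :=
    Measurable.ite (measurableSet_lt measurable_snd.norm measurable_fst)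
      (hf.comp measurable_snd) measurable_const
  convert hK.lintegral_prod_right' (ν := Λ) using 2 with r
  rw [← lintegral_indicator measurableSet_ball]
  refine lintegral_congr fun x => ?_
  by_cases hx : ‖x‖ < r <;> simp [hx]

end CellularNetwork

/-! ### The interference correlation coefficient. -/

theorem theorem1 {Ω : Type*} [MeasurableSpace Ω] (P : Measure Ω) [IsProbabilityMeasure P]
    (lam ε α : ℝ) (hlam : 0 < lam) (hε : 0 < ε) (hα : 2 < α)
    (X : ℕ → Ω → Plane) (h : ℕ → Fin 2 → Ω → ℝ) (hnet : IsRayleighNetwork lam X h P)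
    (g : Plane → ℝ) (hg : g = pathLoss ε α)
    (x₂ : Ω → Plane) (hx₂ : x₂ = servingStation X 0)
    (Eh2 : ℝ) (hEh2 : Eh2 = ∫ y, y ^ 2 ∂fadingLaw)
    (a b : ℝ)
    (ha : a = (∫ ω, g (x₂ ω) ^ 2 ∂P) + (∫ ω, g (x₂ ω) ∂P) ^ 2)
    (hb : b = Eh2 * (∫ ω, g (x₂ ω) ^ 2 ∂P) + (∫ ω, g (x₂ ω) ∂P) ^ 2) :
    -- the serving station is almost surely the unique closest one
    (∀ᵐ ω ∂P, ∀ i, i ≠ servingIndex X 0 ω → ‖x₂ ω‖ < ‖X i ω‖) ∧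
    -- the serving distance has the stated density
    HasLaw (fun ω => ‖x₂ ω‖)
      (volume.withDensity (fun r => ENNReal.ofReal (servingDistanceDensity lam r))) P ∧
    -- the interference is almost surely finite and square integrable, and not degenerate
    (∀ k, ∀ᵐ ω ∂P, Summable (interferencePower ε α X h k 0 ω)) ∧
    (∀ k, MemLp (interference ε α X h k 0) 2 P) ∧
    0 < (∫ ω, interference ε α X h 1 0 ω ^ 2 ∂P) - (∫ ω, interference ε α X h 1 0 ω ∂P) ^ 2 ∧
    interferenceCorrelation P ε α X h 0 0 =
      (lam * (∫ x, g x ^ 2) - a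
          + 2 * lam * ∫ ω, g (x₂ ω) * (∫ x in Metric.ball 0 ‖x₂ ω‖, g x) ∂P) /
        (Eh2 * lam * (∫ x, g x ^ 2) - b
          + 2 * lam * ∫ ω, g (x₂ ω) * (∫ x in Metric.ball 0 ‖x₂ ω‖, g x) ∂P) := by
  rw [integral_sq_fadingLaw] at hEh2
  have hX := hnet.measurable_position
  have hx₂m : Measurable x₂ := hx₂ ▸ measurable_servingStation hX 0
  have hgpos : ∀ x, 0 < g x := fun x => hg ▸ pathLoss_pos hε x
  have hgint : Integrable g := hg ▸ integrable_pathLoss hε hα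
  have hgint2 : Integrable fun x => g x ^ 2 := hg ▸ integrable_pathLoss_sq hε hα
  set Λ : Measure Plane := ENNReal.ofReal lam • (volume : Measure Plane) with hΛ
  -- the path loss with values in the extended nonnegative reals
  set f : ℝ → ℝ≥0∞ := fun r => ENNReal.ofReal (1 / (ε + r ^ α)) with hf
  have hfm : Measurable f := by fun_prop
  have hfg : ∀ x : Plane, f ‖x‖ = ENNReal.ofReal (g x) := fun x => by rw [hg]; rfl
  have hgf : ∀ x : Plane, g x = (f ‖x‖).toReal := fun x => by
    rw [hfg, ENNReal.toReal_ofReal (hgpos x).le]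
  have hFm : Measurable fun x : Plane => f ‖x‖ := hfm.comp measurable_norm
  have hFFm : Measurable fun x : Plane => f ‖x‖ * f ‖x‖ := hFm.mul hFm
  have hftop : ∀ x : Plane, f ‖x‖ < ∞ := fun x => hfg x ▸ ENNReal.ofReal_lt_top
  have htoReal : ∀ s : Set Plane, (∫⁻ x in s, f ‖x‖ ∂Λ).toReal = lam * ∫ x in s, g x := by
    intro s
    have h1 : ∫ x in s, g x = (∫⁻ x in s, f ‖x‖).toReal := by
      simp_rw [hgf]
      exact integral_toReal hFm.aemeasurable (Filter.Eventually.of_forall hftop)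
    rw [h1, hΛ, Measure.restrict_smul, lintegral_smul_measure, smul_eq_mul, ENNReal.toReal_mul,
      ENNReal.toReal_ofReal hlam.le]
  have hLG2 : (∫⁻ x, f ‖x‖ * f ‖x‖ ∂Λ).toReal = lam * ∫ x, g x ^ 2 := by
    have h1 : ∫ x, g x ^ 2 = (∫⁻ x : Plane, f ‖x‖ * f ‖x‖).toReal := by
      simp_rw [hgf, pow_two, ← ENNReal.toReal_mul]
      exact integral_toReal hFFm.aemeasurable
        (Filter.Eventually.of_forall fun x => ENNReal.mul_lt_top (hftop x) (hftop x))
    rw [h1, hΛ, lintegral_smul_measure, smul_eq_mul, ENNReal.toReal_mul,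
      ENNReal.toReal_ofReal hlam.le]
  have hLGfin : ∫⁻ x, f ‖x‖ ∂Λ ≠ ∞ := by
    rw [hΛ, lintegral_smul_measure, smul_eq_mul]
    simp_rw [hfg]
    exact ENNReal.mul_ne_top ENNReal.ofReal_ne_top hgint.lintegral_lt_top.ne
  have hLG2fin : ∫⁻ x, f ‖x‖ * f ‖x‖ ∂Λ ≠ ∞ := by
    rw [hΛ, lintegral_smul_measure, smul_eq_mul]
    have : ∀ x : Plane, f ‖x‖ * f ‖x‖ = ENNReal.ofReal (g x ^ 2) := fun x => by
      rw [hfg, pow_two, ENNReal.ofReal_mul (hgpos x).le]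
    simp_rw [this]
    exact ENNReal.mul_ne_top ENNReal.ofReal_ne_top hgint2.lintegral_lt_top.ne
  -- the total path loss of all stations, of the serving one, and of the interfering ones
  set w := interferenceWeight ε α with hw
  have hwm : ∀ i, Measurable (w i) := measurable_interferenceWeight ε α
  have hwX := fun i => measurable_comp_position hnet (hwm i)
  set F₂ : Ω → ℝ≥0∞ := fun ω => f ‖x₂ ω‖ with hF₂
  set W : Ω → ℝ≥0∞ := fun ω => ∑' i, w i (fun n => X n ω) with hW
  set V : Ω → ℝ≥0∞ := fun ω => ∑' i, w i (fun n => X n ω) * w i (fun n => X n ω) with hV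
  have hF₂m : Measurable F₂ := hfm.comp hx₂m.norm
  have hWm : Measurable W := Measurable.tsum hwX
  have hVm : Measurable V := Measurable.tsum fun i => (hwX i).mul (hwX i)
  have hwX' : ∀ i ω, w i (fun n => X n ω) =
      if i = servingIndex X 0 ω then 0 else f ‖X i ω‖ := fun i ω => rfl
  have hG : ∀ ω, pointSum X (fun x => f ‖x‖) ω = W ω + F₂ ω := fun ω => by
    rw [pointSum_eq_tsum_add_servingStation, hF₂, hx₂]
    rfl
  have hG2 : ∀ ω, pointSum X (fun x => f ‖x‖ * f ‖x‖) ω = V ω + F₂ ω * F₂ ω := fun ω => by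
    rw [pointSum_eq_tsum_add_servingStation, hF₂, hx₂]
    congr 1
    refine tsum_congr fun i => ?_
    rw [hwX']
    split_ifs <;> simp
  have hWFm : Measurable fun ω => W ω * F₂ ω := hWm.mul hF₂m
  have hFF₂m : Measurable fun ω => F₂ ω * F₂ ω := hF₂m.mul hF₂m
  have hWWm : Measurable fun ω => W ω * W ω := hWm.mul hWm
  set B : Ω → ℝ≥0∞ := fun ω => ∫⁻ x in Metric.ball 0 ‖x₂ ω‖, f ‖x‖ ∂Λ with hB
  have hBm : Measurable B := (measurable_lintegral_ball hFm).comp hx₂m.norm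
  -- moment identities
  have e1 : (∫⁻ ω, W ω ∂P) + ∫⁻ ω, F₂ ω ∂P = ∫⁻ x, f ‖x‖ ∂Λ := by
    rw [← lintegral_add_left hWm,
      ← lintegral_pointSum hX hnet.injective_position hnet.poisson hFm]
    simp_rw [hG]
  have e2 : (∫⁻ ω, V ω ∂P) + ∫⁻ ω, F₂ ω * F₂ ω ∂P = ∫⁻ x, f ‖x‖ * f ‖x‖ ∂Λ := by
    rw [← lintegral_add_left hVm,
      ← lintegral_pointSum hX hnet.injective_position hnet.poisson hFFm]
    simp_rw [hG2]
  have e3 : (∫⁻ ω, W ω * W ω ∂P) + 2 * (∫⁻ ω, W ω * F₂ ω ∂P) + ∫⁻ ω, F₂ ω * F₂ ω ∂P =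
      (∫⁻ x, f ‖x‖ ∂Λ) * (∫⁻ x, f ‖x‖ ∂Λ) + ∫⁻ x, f ‖x‖ * f ‖x‖ ∂Λ := by
    rw [← lintegral_const_mul _ hWFm, ← lintegral_add_left hWWm, ← lintegral_add_right _ hFF₂m,
      ← lintegral_pointSum_mul_pointSum hX hnet.injective_position hnet.poisson hFm hFm]
    refine lintegral_congr fun ω => ?_
    rw [hG]
    ring
  -- The cross moment `E[F₂ G]`, with `E[F₂ B]` added to both sides so that the integral outside the
  -- ball is completed to one over the whole plane.
  have e4 : (∫⁻ ω, W ω * F₂ ω ∂P) + (∫⁻ ω, F₂ ω * F₂ ω ∂P) + ∫⁻ ω, F₂ ω * B ω ∂P =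
      (∫⁻ ω, F₂ ω * F₂ ω ∂P) + (∫⁻ ω, F₂ ω ∂P) * ∫⁻ x, f ‖x‖ ∂Λ := by
    have key := lintegral_servingStation_mul_pointSum hlam hnet hfm hLGfin hfm
    rw [← hx₂] at key
    have hleft : ∫⁻ ω, f ‖x₂ ω‖ * pointSum X (fun x => f ‖x‖) ω ∂P =
        (∫⁻ ω, W ω * F₂ ω ∂P) + ∫⁻ ω, F₂ ω * F₂ ω ∂P := by
      rw [← lintegral_add_left hWFm]
      refine lintegral_congr fun ω => ?_
      rw [hG]
      simp only [hF₂]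
      ring
    have hFBm : Measurable fun ω => F₂ ω * B ω := hF₂m.mul hBm
    rw [← hleft, key, ← lintegral_add_right _ hFBm, ← lintegral_mul_const _ hF₂m,
      ← lintegral_add_left hFF₂m]
    refine lintegral_congr fun ω => ?_
    rw [← lintegral_add_compl (μ := Λ) (fun x : Plane => f ‖x‖)
      (measurableSet_ball (x := (0 : Plane)) (ε := ‖x₂ ω‖))]
    simp only [hF₂, hB]
    ring
  -- finiteness
  have fin1 : (∫⁻ ω, W ω ∂P) ≠ ∞ ∧ (∫⁻ ω, F₂ ω ∂P) ≠ ∞ := ENNReal.add_ne_top.1 (e1 ▸ hLGfin)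
  have fin2 : (∫⁻ ω, V ω ∂P) ≠ ∞ ∧ (∫⁻ ω, F₂ ω * F₂ ω ∂P) ≠ ∞ :=
    ENNReal.add_ne_top.1 (e2 ▸ hLG2fin)
  have fin3 : ((∫⁻ ω, W ω * W ω ∂P) ≠ ∞ ∧ 2 * (∫⁻ ω, W ω * F₂ ω ∂P) ≠ ∞) := by
    have : (∫⁻ x, f ‖x‖ ∂Λ) * (∫⁻ x, f ‖x‖ ∂Λ) + ∫⁻ x, f ‖x‖ * f ‖x‖ ∂Λ ≠ ∞ :=
      ENNReal.add_ne_top.2 ⟨ENNReal.mul_ne_top hLGfin hLGfin, hLG2fin⟩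
    rw [← e3] at this
    exact ENNReal.add_ne_top.1 (ENNReal.add_ne_top.1 this).1
  have fin4 : (∫⁻ ω, W ω * F₂ ω ∂P) ≠ ∞ ∧ (∫⁻ ω, F₂ ω * B ω ∂P) ≠ ∞ := by
    have : (∫⁻ ω, F₂ ω * F₂ ω ∂P) + (∫⁻ ω, F₂ ω ∂P) * ∫⁻ x, f ‖x‖ ∂Λ ≠ ∞ :=
      ENNReal.add_ne_top.2 ⟨fin2.2, ENNReal.mul_ne_top fin1.2 hLGfin⟩
    rw [← e4] at this
    have h2 := ENNReal.add_ne_top.1 this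
    exact ⟨(ENNReal.add_ne_top.1 h2.1).1, h2.2⟩
  -- the same identities between real numbers
  have r1 := congrArg ENNReal.toReal e1
  have r2 := congrArg ENNReal.toReal e2
  have r3 := congrArg ENNReal.toReal e3
  have r4 := congrArg ENNReal.toReal e4
  rw [ENNReal.toReal_add fin1.1 fin1.2] at r1
  rw [ENNReal.toReal_add fin2.1 fin2.2, hLG2] at r2
  rw [ENNReal.toReal_add (ENNReal.add_ne_top.2 fin3) fin2.2, ENNReal.toReal_add fin3.1 fin3.2,
    ENNReal.toReal_add (ENNReal.mul_ne_top hLGfin hLGfin) hLG2fin, ENNReal.toReal_mul,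
    ENNReal.toReal_mul, hLG2, ENNReal.toReal_ofNat] at r3
  rw [ENNReal.toReal_add (ENNReal.add_ne_top.2 ⟨fin4.1, fin2.2⟩) fin4.2,
    ENNReal.toReal_add fin4.1 fin2.2,
    ENNReal.toReal_add fin2.2 (ENNReal.mul_ne_top fin1.2 hLGfin), ENNReal.toReal_mul] at r4
  have s1 : ∫ ω, g (x₂ ω) ∂P = (∫⁻ ω, F₂ ω ∂P).toReal := by
    simp_rw [hgf]
    exact integral_toReal hF₂m.aemeasurable (Filter.Eventually.of_forall fun ω => hftop _)
  have s2 : ∫ ω, g (x₂ ω) ^ 2 ∂P = (∫⁻ ω, F₂ ω * F₂ ω ∂P).toReal := by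
    simp_rw [hgf, pow_two, ← ENNReal.toReal_mul]
    exact integral_toReal hFF₂m.aemeasurable
      (Filter.Eventually.of_forall fun ω => ENNReal.mul_lt_top (hftop _) (hftop _))
  have s3 : lam * ∫ ω, g (x₂ ω) * (∫ x in Metric.ball 0 ‖x₂ ω‖, g x) ∂P =
      (∫⁻ ω, F₂ ω * B ω ∂P).toReal := by
    rw [← integral_const_mul]
    have : ∀ ω, lam * (g (x₂ ω) * ∫ x in Metric.ball 0 ‖x₂ ω‖, g x) = (F₂ ω * B ω).toReal := by
      intro ω
      rw [ENNReal.toReal_mul, hB, htoReal, hgf (x₂ ω)]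
      ring
    simp_rw [this]
    refine integral_toReal (hF₂m.mul hBm).aemeasurable (Filter.Eventually.of_forall fun ω => ?_)
    refine ENNReal.mul_lt_top (hftop _) (lt_of_le_of_lt ?_ hLGfin.lt_top)
    exact setLIntegral_le_lintegral _ _
  -- the interference
  have hpos := ae_gain_nonneg hnet
  have hJm := measurable_gainSum hnet hwm
  have hJJ : ∀ k l, ∫⁻ ω, gainSum X h w k ω * gainSum X h w l ω ∂P =
      (∫⁻ ω, W ω * W ω ∂P) + if k = l then ∫⁻ ω, V ω ∂P else 0 :=
    lintegral_gainSum_mul_gainSum hnet hwm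
  have hJfin : ∀ k, ∫⁻ ω, gainSum X h w k ω * gainSum X h w k ω ∂P ≠ ∞ := fun k => by
    rw [hJJ, if_pos rfl]
    exact ENNReal.add_ne_top.2 ⟨fin3.1, fin2.1⟩
  have hJtop : ∀ k, ∀ᵐ ω ∂P, gainSum X h w k ω < ∞ := fun k =>
    ae_lt_top_of_lintegral_mul_self (hJm k) (hJfin k)
  have hI : ∀ k, interference ε α X h k 0 =ᵐ[P] fun ω => (gainSum X h w k ω).toReal := fun k => by
    filter_upwards [hpos] with ω hω
    exact interference_eq_toReal_gainSum hε hω k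
  have m1 : ∫ ω, interference ε α X h 1 0 ω ∂P = (∫⁻ ω, W ω ∂P).toReal := by
    rw [integral_congr_ae (hI 1), integral_toReal (hJm 1).aemeasurable (hJtop 1),
      lintegral_gainSum hnet hwm]
  have m2 : ∀ k l, ∫ ω, interference ε α X h k 0 ω * interference ε α X h l 0 ω ∂P =
      (∫⁻ ω, W ω * W ω ∂P).toReal + if k = l then (∫⁻ ω, V ω ∂P).toReal else 0 := by
    intro k l
    have h1 : ∫ ω, interference ε α X h k 0 ω * interference ε α X h l 0 ω ∂P =
        ∫ ω, (gainSum X h w k ω * gainSum X h w l ω).toReal ∂P := by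
      refine integral_congr_ae ?_
      filter_upwards [hI k, hI l] with ω hk hl
      rw [hk, hl, ENNReal.toReal_mul]
    have hlt : ∀ᵐ ω ∂P, gainSum X h w k ω * gainSum X h w l ω < ∞ := by
      filter_upwards [hJtop k, hJtop l] with ω hk hl using ENNReal.mul_lt_top hk hl
    have hm : Measurable fun ω => gainSum X h w k ω * gainSum X h w l ω := (hJm k).mul (hJm l)
    rw [h1, integral_toReal hm.aemeasurable hlt, hJJ]
    split_ifs
    · rw [ENNReal.toReal_add fin3.1 fin2.1]
    · simp
  have m3 : ∫ ω, interference ε α X h 1 0 ω ^ 2 ∂P =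
      (∫⁻ ω, W ω * W ω ∂P).toReal + (∫⁻ ω, V ω ∂P).toReal := by
    simp_rw [pow_two]
    rw [m2, if_pos rfl]
  -- Nonnegativity of `Var W`; together with `E[V] > 0` it makes the denominator positive.
  have hvar : (∫⁻ ω, W ω ∂P).toReal ^ 2 ≤ (∫⁻ ω, W ω * W ω ∂P).toReal := by
    have hWtop := ae_lt_top_of_lintegral_mul_self hWm fin3.1
    have h1 := variance_nonneg (fun ω => (W ω).toReal) P
    have h2 : ∫ ω, (W ω).toReal ^ 2 ∂P = (∫⁻ ω, W ω * W ω ∂P).toReal := by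
      simp_rw [pow_two, ← ENNReal.toReal_mul]
      refine integral_toReal hWWm.aemeasurable ?_
      filter_upwards [hWtop] with ω hω using ENNReal.mul_lt_top hω hω
    rw [variance_eq_sub (memLp_two_toReal hWm fin3.1)] at h1
    simp only [Pi.pow_apply] at h1
    rw [h2, integral_toReal hWm.aemeasurable hWtop] at h1
    linarith
  have hVpos : 0 < (∫⁻ ω, V ω ∂P).toReal := by
    refine ENNReal.toReal_pos (fun h0 => ?_) fin2.1
    obtain ⟨ω, hω⟩ := ((lintegral_eq_zero_iff hVm).1 h0).exists
    -- Any index other than the serving one would do: its station interferes with positive path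
    -- loss.
    have h1 := ENNReal.tsum_eq_zero.1 hω (servingIndex X 0 ω + 1)
    rw [hwX', if_neg (by omega), hfg] at h1
    simp [(hgpos _).not_ge] at h1
  refine ⟨?_, ?_, ?_, ?_, ?_, ?_⟩
  · rw [hx₂]
    exact ae_servingStation_lt hlam hnet
  · rw [hx₂]
    exact hasLaw_norm_servingStation hlam hnet
  · intro k
    filter_upwards [hpos, hJtop k] with ω hω hfin using summable_interferencePower hε hω hfin
  · exact fun k => (memLp_two_toReal (hJm k) (hJfin k)).ae_eq (hI k).symm
  · rw [m3, m1]
    linarith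
  · rw [interferenceCorrelation, m3, m1, m2, if_neg (by decide), ha, hb, s1, s2, hEh2,
      mul_assoc 2 lam (∫ ω, g (x₂ ω) * (∫ x in Metric.ball 0 ‖x₂ ω‖, g x) ∂P), s3,
      mul_assoc 2 lam (∫ x, g x ^ 2)]
    congr 1
    -- With `L = lam * ∫ g`, the multiple of `r1` encodes `E[W]² = (L - E[F₂])²` as a difference of
    -- squares. The denominator needs `r2` in addition, for the term `E[V]`.
    · linear_combination r3 - 2 * r4 - ((∫⁻ ω, W ω ∂P).toReal - (∫⁻ ω, F₂ ω ∂P).toReal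
        + (∫⁻ x, f ‖x‖ ∂Λ).toReal) * r1
    · linear_combination r2 + r3 - 2 * r4 - ((∫⁻ ω, W ω ∂P).toReal - (∫⁻ ω, F₂ ω ∂P).toReal
        + (∫⁻ x, f ‖x‖ ∂Λ).toReal) * r1
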